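/- Work over $\mathbb C$. For projective varieties $Y\subset\mathbb P^m$, $W\subset\mathbb P^n$ with affine cones $C(Y)\subset\mathbb C^{m+1}$, $C(W)\subset\mathbb C^{n+1}$ (the cone over the empty set being $\{0\}$), the join $Y\#W\subset\mathbb P^{m+n+1}$ is the image of $(C(Y)\times C(W))\setminus\{0\}$; $\mathbb P^n$ and its subsets are regarded as subsets of $\mathbb P^{m+n+1}$ through $[x]\mapsto[0:x]$. The Chow form of a $D$-dimensional irreducible subvariety $V\subset\mathbb P^N$ is the irreducible multihomogeneous form $F_V(\underline u^0,\dots,\underline u^D)$ in $D+1$ groups of $N+1$ variables, unique up to a nonzero constant, such that for all hyperplanes $\xi^0,\dots,\xi^D\subset\mathbb P^N$ with coefficient vectors $\underline\xi^0,\dots,\underline\xi^D$ one has $F_V(\underline\xi^0,\dots,\underline\xi^D)=0$ if and only if $\xi^0\cap\dots\cap\xi^D\cap V\neq\emptyset$. In $\mathbb P^{r+n+1}$ put ${}^t\underline u=(tu_0,\dots,tu_r,u_{r+1},\dots,u_{r+n+1})$ and ${}^tF_V(\underline u^0,\dots,\underline u^D)=F_V({}^t\underline u^0,\dots,{}^t\underline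 u^D)$ for $t\in\mathbb C\setminus\{0\}$. Theorem. Let $X\subset\mathbb P^n$ be an irreducible subvariety, let $r\ge 0$, and let $V$ be an irreducible subvariety of $\mathbb P^r\#X\subset\mathbb P^{r+n+1}$ of degree $d$ which meets $X$ properly in $\mathbb P^r\#X$, i.e. every irreducible component $C$ of $V\cap X$ satisfies $\dim C+\dim(\mathbb P^r\#X)=\dim V+\dim X$. Put $W=V\cap X$. Then $$V=\mathbb P^r\#W\quad\Longleftrightarrow\quad {}^tF_V=t^{(r+1)d}F_V\ \text{ for all } t\in\mathbb C\setminus\{0\}.$$ -/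

import Mathlib

noncomputable section

namespace ChowJoin

/-- The complex projective space with homogeneous coordinates indexed by `σ`;
`PSpace (Fin (n + 1))` is `ℙⁿ`. -/
abbrev PSpace (σ : Type) : Type := Projectivization ℂ (σ → ℂ)

/-- The affine cone over a subset of projective space: the preimage under the quotient map,
together with the origin. -/
def cone {σ : Type} (V : Set (PSpace σ)) : Set (σ → ℂ) :=
  {v | ∀ h : v ≠ 0, Projectivization.mk ℂ v h ∈ V}

/-- `V` is the common zero locus of a set of homogeneous polynomials. -/
def IsProjClosed {σ : Type} (V : Set (PSpace σ)) : Prop :=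
  ∃ S : Set (MvPolynomial σ ℂ), (∀ f ∈ S, ∃ e : ℕ, f.IsHomogeneous e) ∧
    ∀ p : PSpace σ, p ∈ V ↔ ∀ f ∈ S, MvPolynomial.eval p.rep f = 0

/-- Irreducible (closed, nonempty) subvarieties of projective space. -/
structure IsIrredVariety {σ : Type} (V : Set (PSpace σ)) : Prop where
  isClosed : IsProjClosed V
  nonempty : V.Nonempty
  irred : ∀ A B : Set (PSpace σ), IsProjClosed A → IsProjClosed B →
    V ⊆ A ∪ B → V ⊆ A ∨ V ⊆ B

/-- `C` is an irreducible component of `V`. -/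
def IsIrredComponent {σ : Type} (C V : Set (PSpace σ)) : Prop :=
  Maximal (fun Z : Set (PSpace σ) => IsIrredVariety Z ∧ Z ⊆ V) C

/-- The Krull dimension of the homogeneous coordinate ring of `V`, i.e. the dimension of the
affine cone over `V`. -/
def coneDim {σ : Type} (V : Set (PSpace σ)) : WithBot ℕ∞ :=
  ringKrullDim (MvPolynomial σ ℂ ⧸ MvPolynomial.vanishingIdeal ℂ (cone V))

/-- `V` has dimension `D`: its affine cone has dimension `D + 1`. -/
def HasDim {σ : Type} (V : Set (PSpace σ)) (D : ℕ) : Prop :=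
  coneDim V = (D : WithBot ℕ∞) + 1

/-- `V` and `X` meet properly in `Z`: every irreducible component `C` of `V ∩ X` satisfies
`dim C + dim Z = dim V + dim X`. The shift by one between the dimension of a variety and that of
its cone occurs twice on both sides. -/
def MeetsProperly {σ : Type} (V X Z : Set (PSpace σ)) : Prop :=
  ∀ C : Set (PSpace σ), IsIrredComponent C (V ∩ X) →
    coneDim C + coneDim Z = coneDim V + coneDim X

/-- The linear subspace of projective space defined by a vector subspace. -/
def linearSubspace {σ : Type} (L : Submodule ℂ (σ → ℂ)) : Set (PSpace σ) :=
  {p | p.rep ∈ L}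

/-- The degree of a variety `V`: the largest number of points in which `V` meets a linear subspace
of codimension `dim V`, among those linear subspaces which meet `V` in finitely many points. -/
def degree {σ : Type} [Fintype σ] (V : Set (PSpace σ)) : ℕ :=
  sSup {m : ℕ | ∃ L : Submodule ℂ (σ → ℂ),
    (Module.finrank ℂ L : WithBot ℕ∞) + coneDim V = (Fintype.card σ : WithBot ℕ∞) + 1 ∧
    (V ∩ linearSubspace L).Finite ∧ (V ∩ linearSubspace L).ncard = m}

/-- The join `Y # W`: the image in projective space of `C(Y) × C(W)` minus the origin. -/
def join {σ τ : Type} (Y : Set (PSpace σ)) (W : Set (PSpace τ)) : Set (PSpace (σ ⊕ τ)) :=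
  {p | ∃ y ∈ cone Y, ∃ w ∈ cone W, ∃ h : Sum.elim y w ≠ 0,
    p = Projectivization.mk ℂ (Sum.elim y w) h}

/-- The linear map `w ↦ (0, w)`. -/
def inrLinear (σ τ : Type) : (τ → ℂ) →ₗ[ℂ] (σ ⊕ τ → ℂ) where
  toFun w := Sum.elim 0 w
  map_add' v w := by ext (i | i) <;> simp
  map_smul' c w := by ext (i | i) <;> simp

theorem inrLinear_injective (σ τ : Type) : Function.Injective (inrLinear σ τ) := by
  intro v w h
  ext i
  exact congrFun h (Sum.inr i)

/-- The embedding `[x] ↦ [0 : x]` of the second factor into the ambient space of the join. -/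
def embR (σ τ : Type) : PSpace τ → PSpace (σ ⊕ τ) :=
  Projectivization.map (inrLinear σ τ) (inrLinear_injective σ τ)

/-- `F` is a Chow form of the `D`-dimensional variety `V`: an irreducible multihomogeneous form in
`D + 1` groups of variables `u⁰, …, u^D` whose zero set is the set of all tuples of hyperplanes
`ξ⁰, …, ξ^D` having a common point on `V`. The hyperplane with (not all zero) coefficients `a` is
`∑ j, a j * x j = 0`. -/
structure IsChowForm {σ : Type} [Fintype σ] (V : Set (PSpace σ)) {D : ℕ}
    (F : MvPolynomial (Fin (D + 1) × σ) ℂ) : Prop where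
  hasDim : HasDim V D
  irreducible : Irreducible F
  multihomogeneous : ∀ i : Fin (D + 1), ∃ e : ℕ,
    F.IsWeightedHomogeneous (fun q : Fin (D + 1) × σ => if q.1 = i then 1 else 0) e
  eval_eq_zero_iff : ∀ ξ : Fin (D + 1) → σ → ℂ, (∀ i, ξ i ≠ 0) →
    (MvPolynomial.eval (fun q => ξ q.1 q.2) F = 0 ↔
      ∃ p ∈ V, ∀ i, ∑ j, ξ i j * p.rep j = 0)

/-- `ᵗF`, i.e. `F(ᵗu⁰, …, ᵗu^D)` where `ᵗu` multiplies the first group of coordinates by `t`. -/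
def scaleForm {σ τ : Type} {D : ℕ} (t : ℂ) (F : MvPolynomial (Fin (D + 1) × (σ ⊕ τ)) ℂ) :
    MvPolynomial (Fin (D + 1) × (σ ⊕ τ)) ℂ :=
  MvPolynomial.bind₁ (fun q : Fin (D + 1) × (σ ⊕ τ) =>
    Sum.elim (fun _ => MvPolynomial.C t * MvPolynomial.X q) (fun _ => MvPolynomial.X q) q.2) F

end ChowJoin

end

/-!
If `V` is the join `ℙ(σ) # W`, then it is stable under the torus action `(x, y) ↦ (t x, y)`. Hence
`F` divides each `ᵗF`, which is therefore a constant multiple of `F`. To find the constant, evaluate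
at the coordinate hyperplanes of `ℙ(σ)` together with `dim W + 1` general hyperplanes in the other
coordinates: this tuple has no common point on `V`, and the action multiplies `card σ` of its rows
by `t`. The form `F` has degree `deg V` in each row, because restricted to a general pencil of
hyperplanes in one row it has simple roots, one for each point of a linear section of `V`.

Conversely, if every `ᵗF` is a nonzero multiple of `F`, then `V` is stable under the action, since
`F` detects membership in `V` by hyperplanes through a point. Letting `t → 0`, it is also stable
under the projection `(x, y) ↦ (0, y)`, so `V ⊆ ℙ(σ) # W`, and `W` is irreducible as the image of
`V` unless it is empty. It remains to compare dimensions. For nonempty `W`, equality is the proper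
intersection hypothesis. If `W` is empty, `V` lies in `ℙ(σ)` and `ᵗF = t ^ ((D + 1) deg V) F`, so
the exponent says that `D + 1 = card σ`.
-/

noncomputable section

namespace ChowJoin

open MvPolynomial

/-! ### Polynomials on lines -/

section Lines

variable {ι R : Type*}

theorem eval_pow_mul_of_isWeightedHomogeneous [CommSemiring R] {w : ι → ℕ}
    {P : MvPolynomial ι R} {e : ℕ} (hP : P.IsWeightedHomogeneous w e) (t : R) (x : ι → R) :
    eval (fun q => t ^ w q * x q) P = t ^ e * eval x P := by
  simp only [eval_eq, Finset.mul_sum]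
  refine Finset.sum_congr rfl fun m hm => ?_
  have hweight : ∑ q ∈ m.support, w q * m q = e := by
    have := hP (mem_support_iff.mp hm)
    rw [Finsupp.weight_apply, Finsupp.sum] at this
    simpa [mul_comm] using this
  rw [← hweight, ← Finset.prod_pow_eq_pow_sum, mul_left_comm, ← Finset.prod_mul_distrib]
  simp_rw [mul_pow, pow_mul]

theorem eval_smul_of_isHomogeneous [CommSemiring R] {P : MvPolynomial ι R} {e : ℕ}
    (hP : P.IsHomogeneous e) (t : R) (x : ι → R) : eval (t • x) P = t ^ e * eval x P := by
  rw [← eval_pow_mul_of_isWeightedHomogeneous hP t x]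
  simp [Pi.smul_def]

variable [CommRing R]

/-- Restriction of polynomials to the line `t ↦ x + t • y`. The coordinates of `x` and `y` may lie
in a larger ring than the coefficients, so that `x` can be taken to be the generic point. -/
def restrictLine {S : Type*} [CommRing S] [Algebra R S] (x y : ι → S) :
    MvPolynomial ι R →ₐ[R] Polynomial S :=
  aeval fun q => Polynomial.C (x q) + Polynomial.C (y q) * Polynomial.X

theorem eval_restrictLine (x y : ι → R) (P : MvPolynomial ι R) (t : R) :
    (restrictLine x y P).eval t = eval (x + t • y) P := by
  have hcomp : (Polynomial.aeval t).comp (restrictLine x y) = aeval (R := R) (x + t • y) := by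
    ext q
    simp [restrictLine, mul_comm t]
  exact DFunLike.congr_fun hcomp P

theorem map_restrictLine {S T : Type*} [CommRing S] [Algebra R S] [CommRing T] [Algebra R T]
    (φ : S →ₐ[R] T) (x y : ι → S) (P : MvPolynomial ι R) :
    (restrictLine x y P).map (φ : S →+* T) = restrictLine (φ ∘ x) (φ ∘ y) P := by
  have hcomp : (Polynomial.mapAlgHom φ).comp (restrictLine x y) =
      restrictLine (R := R) (φ ∘ x) (φ ∘ y) := by
    ext q : 1
    simp [restrictLine]
  exact DFunLike.congr_fun hcomp P

theorem natDegree_prod_pow_le_and_coeff {s : Finset ι} {f : ι → Polynomial R} {a : ι → ℕ}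
    (h : ∀ q ∈ s, (f q).natDegree ≤ a q) (m : ι → ℕ) :
    (∏ q ∈ s, f q ^ m q).natDegree ≤ ∑ q ∈ s, m q * a q ∧
      (∏ q ∈ s, f q ^ m q).coeff (∑ q ∈ s, m q * a q) = ∏ q ∈ s, (f q).coeff (a q) ^ m q := by
  classical
  induction s using Finset.induction_on with
  | empty => simp
  | insert q s hq ih =>
    obtain ⟨hdeg, hcoeff⟩ := ih fun x hx => h x (Finset.mem_insert_of_mem hx)
    have hq_deg := h q (Finset.mem_insert_self _ _)
    have hpow_deg : (f q ^ m q).natDegree ≤ m q * a q :=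
      Polynomial.natDegree_pow_le_of_le _ hq_deg
    rw [Finset.prod_insert hq, Finset.sum_insert hq, Finset.prod_insert hq]
    refine ⟨Polynomial.natDegree_mul_le_of_le hpow_deg hdeg, ?_⟩
    rw [Polynomial.coeff_mul_add_eq_of_natDegree_le hpow_deg hdeg, hcoeff,
      Polynomial.coeff_pow_of_natDegree_le hq_deg]

theorem natDegree_aeval_le_and_coeff {w : ι → ℕ} {P : MvPolynomial ι R} {e : ℕ}
    (hP : P.IsWeightedHomogeneous w e) {f : ι → Polynomial R} (hf : ∀ q, (f q).natDegree ≤ w q) :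
    (aeval f P).natDegree ≤ e ∧ (aeval f P).coeff e = eval (fun q => (f q).coeff (w q)) P := by
  have hmonomial : ∀ m ∈ P.support, (∏ q ∈ m.support, f q ^ m q).natDegree ≤ e ∧
      (∏ q ∈ m.support, f q ^ m q).coeff e = ∏ q ∈ m.support, (f q).coeff (w q) ^ m q := by
    intro m hm
    have hweight : ∑ q ∈ m.support, m q * w q = e := by
      simpa [Finsupp.weight_apply, Finsupp.sum] using hP (mem_support_iff.mp hm)
    exact hweight ▸ natDegree_prod_pow_le_and_coeff (fun q _ => hf q) m
  have hsum : aeval f P =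
      ∑ m ∈ P.support, Polynomial.C (coeff m P) * ∏ q ∈ m.support, f q ^ m q := by
    rw [aeval_def, eval₂_eq]
    rfl
  rw [hsum, eval_eq, Polynomial.finsetSum_coeff]
  refine ⟨Polynomial.natDegree_sum_le_of_forall_le _ _ fun m hm =>
    (Polynomial.natDegree_C_mul_le _ _).trans (hmonomial m hm).1,
    Finset.sum_congr rfl fun m hm => ?_⟩
  rw [Polynomial.coeff_C_mul, (hmonomial m hm).2]

/-- The endomorphism of `R[x][t]` fixing `t` and sending `x` to `x + t • y`. -/
def shear (y : ι → R) : Polynomial (MvPolynomial ι R) →+* Polynomial (MvPolynomial ι R) :=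
  Polynomial.eval₂RingHom (restrictLine X (C ∘ y)).toRingHom Polynomial.X

theorem shear_C (y : ι → R) (P : MvPolynomial ι R) :
    shear y (Polynomial.C P) = restrictLine X (C ∘ y) P := by
  simp [shear]

theorem shear_comp_shear_neg (y : ι → R) : (shear y).comp (shear (-y)) = RingHom.id _ := by
  refine Polynomial.ringHom_ext' (MvPolynomial.ringHom_ext (fun a => ?_) fun q => ?_) ?_
  · simp [shear, restrictLine]
  · simp [shear, restrictLine]
  · simp [shear]

theorem irreducible_restrictLine_X [IsDomain R] {F : MvPolynomial ι R} (hF : Prime F)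
    (y : ι → R) : Irreducible (restrictLine X (C ∘ y) F) := by
  let e := RingEquiv.ofRingHom (shear y) (shear (-y)) (shear_comp_shear_neg y)
    (by simpa using shear_comp_shear_neg (-y))
  rw [← shear_C]
  exact (MulEquiv.irreducible_iff e).mpr (Polynomial.prime_C_iff.mpr hF).irreducible

theorem exists_ne_zero_forall_separable_map [IsDomain R] [UniqueFactorizationMonoid R] [CharZero R]
    {f : Polynomial R} (hf : Irreducible f) (hdeg : f.natDegree ≠ 0) :
    ∃ r : R, r ≠ 0 ∧ ∀ {K : Type*} [Field K] (φ : R →+* K), φ r ≠ 0 →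
      (f.map φ).Separable ∧ (f.map φ).natDegree = f.natDegree := by
  let L := FractionRing R
  have : CharZero L := charZero_of_injective_algebraMap (IsFractionRing.injective R L)
  have hinj := IsFractionRing.injective R L
  have hsep : (f.map (algebraMap R L)).Separable :=
    ((hf.isPrimitive hdeg).irreducible_iff_irreducible_map_fraction_map.mp hf).separable
  have hres : f.resultant f.derivative ≠ 0 := by
    intro h
    apply Polynomial.resultant_ne_zero _ _ hsep
    rw [Polynomial.derivative_map, Polynomial.natDegree_map_eq_of_injective hinj,
      Polynomial.natDegree_map_eq_of_injective hinj, Polynomial.resultant_map_map, h, map_zero]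
  refine ⟨f.resultant f.derivative * f.leadingCoeff, mul_ne_zero hres (by simpa using hf.ne_zero),
    fun φ hφ => ?_⟩
  obtain ⟨hφres, hφlead⟩ := mul_ne_zero_iff.mp (map_mul φ _ _ ▸ hφ)
  refine ⟨?_, Polynomial.natDegree_map_of_leadingCoeff_ne_zero φ hφlead⟩
  obtain ⟨p, q, -, -, hpq⟩ := Polynomial.exists_mul_add_mul_eq_C_resultant f f.derivative le_rfl
    le_rfl (Or.inl hdeg)
  have hbezout := congrArg (Polynomial.map φ) hpq
  simp only [Polynomial.map_add, Polynomial.map_mul, Polynomial.map_C,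
    ← Polynomial.derivative_map] at hbezout
  let c := Polynomial.C (φ (f.resultant f.derivative))⁻¹
  refine (Polynomial.separable_def' _).mpr ⟨c * p.map φ, c * q.map φ, ?_⟩
  rw [mul_assoc, mul_assoc, ← mul_add, mul_comm (p.map φ), mul_comm (q.map φ), hbezout,
    ← Polynomial.C_mul, inv_mul_cancel₀ hφres, Polynomial.C_1]

variable {K : Type*} [Field K]

theorem exists_eval_ne_zero [Infinite K] {P : MvPolynomial ι K} (hP : P ≠ 0) :
    ∃ x, eval x P ≠ 0 := by
  by_contra! h
  exact hP (MvPolynomial.funext fun x => by simpa using h x)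

theorem exists_separable_restrictLine [CharZero K] {F : MvPolynomial ι K} (hF : Irreducible F)
    {x₀ y : ι → K} (h₀ : (restrictLine x₀ y F).natDegree ≠ 0) :
    ∃ x, (restrictLine x y F).Separable ∧
      (restrictLine x₀ y F).natDegree ≤ (restrictLine x y F).natDegree := by
  have hspecialize (x : ι → K) :
      (restrictLine X (C ∘ y) F).map (aeval x : MvPolynomial ι K →ₐ[K] K) = restrictLine x y F := by
    rw [map_restrictLine]
    congr 2 <;> ext q <;> simp
  have hle := (hspecialize x₀ ▸ Polynomial.natDegree_map_le :
    (restrictLine x₀ y F).natDegree ≤ (restrictLine X (C ∘ y) F).natDegree)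
  obtain ⟨r, hr, hsep⟩ := exists_ne_zero_forall_separable_map
    (irreducible_restrictLine_X hF.prime y) (by lia)
  obtain ⟨x, hx⟩ := exists_eval_ne_zero hr
  have hx_sep := hsep (K := K) (aeval x : MvPolynomial ι K →ₐ[K] K) hx
  rw [hspecialize] at hx_sep
  exact ⟨x, hx_sep.1, hle.trans_eq hx_sep.2.symm⟩

theorem dvd_of_forall_eval_eq_zero [IsAlgClosed K] [Finite ι] {F G : MvPolynomial ι K}
    (hF : Irreducible F) (h : ∀ x, eval x F = 0 → eval x G = 0) : F ∣ G := by
  have : (Ideal.span {F}).IsPrime := (Ideal.span_singleton_prime hF.ne_zero).mpr hF.prime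
  rw [← Ideal.mem_span_singleton, ← IsPrime.vanishingIdeal_zeroLocus (K := K) (Ideal.span {F})]
  exact fun x hx => h x (hx F (Ideal.mem_span_singleton_self F))

end Lines

/-! ### Multihomogeneous forms -/

section RowHomogeneous

open Function (uncurry update)

variable {κ σ : Type*} [DecidableEq κ]

/-- `F`, a polynomial in groups of variables indexed by `κ` (the rows of a matrix of variables), is
homogeneous of degree `e` in the `i`-th group. -/
def IsRowHomogeneous {R : Type*} [CommSemiring R] (F : MvPolynomial (κ × σ) R) (i : κ) (e : ℕ) :
    Prop :=
  F.IsWeightedHomogeneous (fun q => if q.1 = i then 1 else 0) e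

section CommRing

variable {R : Type*} [CommRing R] {F : MvPolynomial (κ × σ) R} {i : κ} {e : ℕ}

theorem IsRowHomogeneous.eval_update_smul (hF : IsRowHomogeneous F i e) (ξ : κ → σ → R) (t : R) :
    eval (uncurry (update ξ i (t • ξ i))) F = t ^ e * eval (uncurry ξ) F := by
  rw [← eval_pow_mul_of_isWeightedHomogeneous hF t]
  congr 2
  ext ⟨k, j⟩
  by_cases hk : k = i
  · subst hk
    simp [uncurry]
  · simp [uncurry, hk]

theorem eval_smul_rows [Fintype κ] {e : κ → ℕ} (hF : ∀ i, IsRowHomogeneous F i (e i)) (c : κ → R)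
    (ξ : κ → σ → R) :
    eval (uncurry fun i => c i • ξ i) F = (∏ i, c i ^ e i) * eval (uncurry ξ) F := by
  suffices ∀ s : Finset κ, eval (uncurry (s.piecewise (fun i => c i • ξ i) ξ)) F =
      (∏ i ∈ s, c i ^ e i) * eval (uncurry ξ) F by
    simpa using this Finset.univ
  intro s
  induction s using Finset.induction_on with
  | empty => simp
  | insert k s hk ih =>
    have hrow : s.piecewise (fun i => c i • ξ i) ξ k = ξ k := by simp [hk]
    rw [Finset.piecewise_insert, ← hrow, (hF k).eval_update_smul, ih, Finset.prod_insert hk,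
      mul_assoc]

theorem uncurry_add_smul_single (ξ : κ → σ → R) (i : κ) (w : σ → R) (t : R) :
    uncurry ξ + t • uncurry (Pi.single i w) = uncurry (update ξ i (ξ i + t • w)) := by
  ext ⟨k, j⟩
  by_cases hk : k = i
  · subst hk
    simp [uncurry]
  · simp [uncurry, hk]

theorem IsRowHomogeneous.restrictLine_natDegree_le_and_coeff (hF : IsRowHomogeneous F i e)
    (ξ : κ → σ → R) (w : σ → R) :
    (restrictLine (uncurry ξ) (uncurry (Pi.single i w)) F).natDegree ≤ e ∧
      (restrictLine (uncurry ξ) (uncurry (Pi.single i w)) F).coeff e =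
        eval (uncurry (update ξ i w)) F := by
  obtain ⟨hdeg, hcoeff⟩ := natDegree_aeval_le_and_coeff hF
    (f := fun q => Polynomial.C (uncurry ξ q) +
      Polynomial.C (uncurry (Pi.single i w) q) * Polynomial.X) (by
    rintro ⟨k, j⟩
    by_cases hk : k = i
    · simp only [hk, if_true]
      compute_degree
    · simp [uncurry, hk])
  refine ⟨hdeg, hcoeff.trans ?_⟩
  congr 2
  ext ⟨k, j⟩
  by_cases hk : k = i
  · subst hk
    simp [uncurry, Polynomial.coeff_C]
  · simp [uncurry, hk]

theorem IsRowHomogeneous.natDegree_restrictLine_insertNth {n : ℕ} {i : Fin (n + 1)}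
    {F : MvPolynomial (Fin (n + 1) × σ) R} (hF : IsRowHomogeneous F i e) {w : σ → R}
    {ζ : Fin n → σ → R} (hw : eval (uncurry (i.insertNth w ζ)) F ≠ 0) (u : σ → R) :
    (restrictLine (uncurry (i.insertNth u ζ)) (uncurry (Pi.single i w)) F).natDegree = e := by
  obtain ⟨hle, hcoeff⟩ := hF.restrictLine_natDegree_le_and_coeff (i.insertNth u ζ) w
  rw [Fin.update_insertNth] at hcoeff
  exact hle.antisymm (Polynomial.le_natDegree_of_ne_zero (hcoeff ▸ hw))

end CommRing

theorem IsRowHomogeneous.exists_ne_zero_eval_update_eq_zero {K : Type*} [Field K] [IsAlgClosed K]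
    [Nontrivial σ] {F : MvPolynomial (κ × σ) K} {i : κ} {e : ℕ} (hF : IsRowHomogeneous F i e)
    (he : e ≠ 0) (ξ : κ → σ → K) : ∃ u ≠ 0, eval (uncurry (update ξ i u)) F = 0 := by
  classical
  obtain ⟨a, b, hab⟩ := exists_pair_ne σ
  by_cases hb : eval (uncurry (update ξ i (Pi.single b 1))) F = 0
  · exact ⟨Pi.single b 1, by simp, hb⟩
  let ζ := update ξ i (Pi.single a 1)
  let P := restrictLine (uncurry ζ) (uncurry (Pi.single i (Pi.single b 1))) F
  have hcoeff : P.coeff e ≠ 0 := by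
    rwa [(hF.restrictLine_natDegree_le_and_coeff ζ _).2, Function.update_idem]
  obtain ⟨t, ht⟩ := IsAlgClosed.exists_root P fun hdeg =>
    hcoeff (Polynomial.coeff_eq_zero_of_degree_lt (by simpa [hdeg, Nat.pos_iff_ne_zero] using he))
  refine ⟨Pi.single a 1 + t • Pi.single b 1, fun h => ?_, ?_⟩
  · simpa [hab] using congrFun h a
  · rw [Polynomial.IsRoot, eval_restrictLine, uncurry_add_smul_single] at ht
    simpa [ζ] using ht

theorem exists_rowDegree_ne_zero {K : Type*} [Field K] [Finite κ] [Infinite K]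
    {F : MvPolynomial (κ × σ) K} (hF : Irreducible F) {e : κ → ℕ}
    (he : ∀ i, IsRowHomogeneous F i (e i)) : ∃ i, e i ≠ 0 := by
  cases nonempty_fintype κ
  by_contra! h0
  have hconst : F = C (eval 0 F) := MvPolynomial.funext fun x => by
    have hscale := eval_smul_rows he 0 (Function.curry x)
    simp only [h0, pow_zero, Finset.prod_const_one, one_mul, Function.uncurry_curry] at hscale
    rw [eval_C, ← hscale]
    congr 2
    ext q
    simp [uncurry]
  rw [hconst] at hF
  by_cases hzero : eval 0 F = 0
  · exact hF.ne_zero (by rw [hzero, C_0])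
  · exact hF.not_isUnit ((isUnit_iff_ne_zero.mpr hzero).map C)

end RowHomogeneous

/-! ### Cones, vanishing ideals and dimension -/

section Cone

variable {σ : Type} {V W A : Set (PSpace σ)}

theorem zero_mem_cone : (0 : σ → ℂ) ∈ cone V := fun h => absurd rfl h

theorem mk_mem_iff {v : σ → ℂ} (hv : v ≠ 0) : Projectivization.mk ℂ v hv ∈ V ↔ v ∈ cone V :=
  ⟨fun h _ => h, fun h => h hv⟩

theorem rep_mem_cone_iff {p : PSpace σ} : p.rep ∈ cone V ↔ p ∈ V := by
  rw [← mk_mem_iff p.rep_nonzero, p.mk_rep]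

theorem smul_mem_cone {v : σ → ℂ} (hv : v ∈ cone V) (c : ℂ) : c • v ∈ cone V := by
  intro hcv
  have hv0 : v ≠ 0 := fun h0 => hcv (by simp [h0])
  rw [(Projectivization.mk_eq_mk_iff' ℂ _ _ hcv hv0).mpr ⟨c, rfl⟩]
  exact hv hv0

theorem cone_subset_cone : cone V ⊆ cone W ↔ V ⊆ W :=
  ⟨fun h _ hp => rep_mem_cone_iff.mp (h (rep_mem_cone_iff.mpr hp)), fun h _ hv h0 => h (hv h0)⟩

theorem exists_rep_iff {P : (σ → ℂ) → Prop} (hP : ∀ (c : ℂ) v, P v → P (c • v)) :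
    (∃ p ∈ V, P p.rep) ↔ ∃ v ∈ cone V, v ≠ 0 ∧ P v := by
  constructor
  · rintro ⟨p, hp, h⟩
    exact ⟨p.rep, rep_mem_cone_iff.mpr hp, p.rep_nonzero, h⟩
  · rintro ⟨v, hv, h0, h⟩
    obtain ⟨a, ha⟩ := Projectivization.exists_smul_eq_mk_rep ℂ v h0
    exact ⟨Projectivization.mk ℂ v h0, hv h0, ha ▸ hP _ _ h⟩

theorem eval_mk_rep_eq_zero_iff {f : MvPolynomial σ ℂ} {e : ℕ} (hf : f.IsHomogeneous e)
    {v : σ → ℂ} (hv : v ≠ 0) : eval (Projectivization.mk ℂ v hv).rep f = 0 ↔ eval v f = 0 := by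
  obtain ⟨a, ha⟩ := Projectivization.exists_smul_eq_mk_rep ℂ v hv
  rw [← ha, Units.smul_def, eval_smul_of_isHomogeneous hf]
  simp

theorem IsProjClosed.inter (hV : IsProjClosed V) (hW : IsProjClosed W) : IsProjClosed (V ∩ W) := by
  obtain ⟨S, hS, hV⟩ := hV
  obtain ⟨T, hT, hW⟩ := hW
  refine ⟨S ∪ T, fun f hf => hf.elim (hS f) (hT f), fun p => ?_⟩
  simp only [Set.mem_inter_iff, hV, hW, Set.mem_union, or_imp, forall_and]

theorem IsProjClosed.mem_cone_iff (hV : IsProjClosed V) {v : σ → ℂ} :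
    v ∈ cone V ↔ ∀ f ∈ vanishingIdeal ℂ (cone V), eval v f = 0 := by
  refine ⟨fun hv f hf => hf v hv, fun h hv => ?_⟩
  obtain ⟨S, hS, hmem⟩ := hV
  rw [hmem]
  intro f hf
  obtain ⟨e, he⟩ := hS f hf
  obtain ⟨j, hj⟩ := Function.ne_iff.mp hv
  have hfX : f * X j ∈ vanishingIdeal ℂ (cone V) := by
    intro u hu
    rw [map_mul]
    by_cases hu0 : u = 0
    · simp [hu0]
    · have hfu := (eval_mk_rep_eq_zero_iff he hu0).mp ((hmem _).mp (hu hu0) f hf)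
      exact mul_eq_zero_of_left hfu _
  have hprod := h _ hfX
  rw [map_mul, eval_X] at hprod
  exact (eval_mk_rep_eq_zero_iff he hv).mpr ((mul_eq_zero.mp hprod).resolve_right hj)

theorem IsProjClosed.vanishingIdeal_le_iff (hA : IsProjClosed A) :
    vanishingIdeal ℂ (cone A) ≤ vanishingIdeal ℂ (cone V) ↔ V ⊆ A :=
  ⟨fun h => cone_subset_cone.mp fun _ hv => hA.mem_cone_iff.mpr fun _ hf => h hf _ hv,
    fun h => vanishingIdeal_anti_mono (cone_subset_cone.mpr h)⟩

theorem IsProjClosed.mem_cone_of_forall_add_smul_mem (hV : IsProjClosed V) {x y : σ → ℂ}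
    (h : ∀ t : ℂ, t ≠ 0 → x + t • y ∈ cone V) : x ∈ cone V := by
  rw [hV.mem_cone_iff]
  intro f hf
  have hroots : {t : ℂ | t ≠ 0} ⊆ {t | (restrictLine x y f).IsRoot t} := fun t ht =>
    (eval_restrictLine x y f t).trans (hf _ (h t ht))
  have hzero : restrictLine x y f = 0 := Polynomial.eq_zero_of_infinite_isRoot _
    ((Set.finite_singleton (0 : ℂ)).infinite_compl.mono hroots)
  simpa [hzero] using (eval_restrictLine x y f 0).symm

theorem restrictLine_zero_of_isHomogeneous {f : MvPolynomial σ ℂ} {e : ℕ} (hf : f.IsHomogeneous e)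
    (v : σ → ℂ) : restrictLine 0 v f = Polynomial.C (eval v f) * Polynomial.X ^ e := by
  refine Polynomial.funext fun t => ?_
  rw [eval_restrictLine, zero_add, eval_smul_of_isHomogeneous hf, mul_comm]
  simp

theorem coeff_restrictLine_zero (v : σ → ℂ) (f : MvPolynomial σ ℂ) (e : ℕ) :
    (restrictLine 0 v f).coeff e = eval v (homogeneousComponent e f) := by
  conv_lhs => rw [← sum_homogeneousComponent f, map_sum, Polynomial.finsetSum_coeff]
  simp only [restrictLine_zero_of_isHomogeneous (homogeneousComponent_isHomogeneous _ f),
    Polynomial.coeff_C_mul, Polynomial.coeff_X_pow, mul_ite, mul_one, mul_zero, Finset.sum_ite_eq,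
    Finset.mem_range, ite_eq_left_iff]
  intro he
  rw [homogeneousComponent_eq_zero _ _ (by lia), map_zero]

attribute [local instance] MvPolynomial.gradedAlgebra

theorem isHomogeneous_vanishingIdeal_cone (V : Set (PSpace σ)) :
    (vanishingIdeal ℂ (cone V)).IsHomogeneous (homogeneousSubmodule σ ℂ) := by
  intro e f hf
  rw [show (DirectSum.decompose (homogeneousSubmodule σ ℂ) f e : MvPolynomial σ ℂ) =
    homogeneousComponent e f from decomposition.decompose'_apply ..]
  intro v hv
  have hzero : restrictLine 0 v f = 0 := Polynomial.funext fun t => by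
    rw [eval_restrictLine, zero_add, Polynomial.eval_zero]
    exact hf _ (smul_mem_cone hv t)
  exact (coeff_restrictLine_zero v f e).symm.trans (by rw [hzero, Polynomial.coeff_zero])

theorem vanishingIdeal_cone_ne_top : vanishingIdeal ℂ (cone V) ≠ ⊤ := by
  rw [Ideal.ne_top_iff_one]
  intro h
  simpa using h 0 zero_mem_cone

theorem isProjClosed_setOf_eval_rep {f : MvPolynomial σ ℂ} {e : ℕ} (hf : f.IsHomogeneous e) :
    IsProjClosed {p : PSpace σ | eval p.rep f = 0} :=
  ⟨{f}, by rintro _ rfl; exact ⟨e, hf⟩, by simp⟩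

theorem mem_vanishingIdeal_of_forall_rep (hV : V.Nonempty) {f : MvPolynomial σ ℂ} {e : ℕ}
    (hf : f.IsHomogeneous e) (h : ∀ p ∈ V, eval p.rep f = 0) :
    f ∈ vanishingIdeal ℂ (cone V) := by
  intro v hv
  by_cases hv0 : v = 0
  · obtain ⟨p, hp⟩ := hV
    have hscale := eval_smul_of_isHomogeneous hf 0 p.rep
    rwa [h p hp, mul_zero, zero_smul, ← hv0] at hscale
  · exact (eval_mk_rep_eq_zero_iff hf hv0).mp (h _ (hv hv0))

theorem IsIrredVariety.isPrime_vanishingIdeal (hV : IsIrredVariety V) :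
    (vanishingIdeal ℂ (cone V)).IsPrime := by
  refine (isHomogeneous_vanishingIdeal_cone V).isPrime_of_homogeneous_mem_or_mem
    vanishingIdeal_cone_ne_top ?_
  rintro f g ⟨d, hf⟩ ⟨e, hg⟩ hfg
  have hcover : V ⊆ {p | eval p.rep f = 0} ∪ {p | eval p.rep g = 0} := fun p hp =>
    mul_eq_zero.mp ((map_mul _ _ _).symm.trans (hfg _ (rep_mem_cone_iff.mpr hp)))
  exact (hV.irred _ _ (isProjClosed_setOf_eval_rep hf) (isProjClosed_setOf_eval_rep hg) hcover).imp
    (mem_vanishingIdeal_of_forall_rep hV.nonempty hf)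
    (mem_vanishingIdeal_of_forall_rep hV.nonempty hg)

theorem IsProjClosed.isIrredVariety (hV : IsProjClosed V) (hne : V.Nonempty)
    (hprime : (vanishingIdeal ℂ (cone V)).IsPrime) : IsIrredVariety V where
  isClosed := hV
  nonempty := hne
  irred A B hA hB hAB := by
    rw [← hA.vanishingIdeal_le_iff, ← hB.vanishingIdeal_le_iff, ← hprime.mul_le, Ideal.mul_le]
    intro f hf g hg v hv
    have hvAB : v ∈ cone A ∨ v ∈ cone B := by
      by_cases hv0 : v = 0
      · exact Or.inl (hv0 ▸ zero_mem_cone)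
      · exact (hAB (hv hv0)).imp (fun h _ => h) fun h _ => h
    rw [map_mul]
    exact mul_eq_zero.mpr (hvAB.imp (hf v) (hg v))

end Cone

section Dimension

variable {σ : Type} {V Z : Set (PSpace σ)}

theorem coneDim_le_card [Fintype σ] (V : Set (PSpace σ)) : coneDim V ≤ (Fintype.card σ : ℕ) := by
  refine (ringKrullDim_quotient_le _).trans ?_
  rw [MvPolynomial.ringKrullDim_of_isNoetherianRing, ringKrullDim_eq_zero_of_field, zero_add,
    Nat.card_eq_fintype_card]

theorem exists_coneDim_eq_natCast [Finite σ] (V : Set (PSpace σ)) :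
    ∃ d : ℕ, coneDim V = d := by
  cases nonempty_fintype σ
  have : Nontrivial (MvPolynomial σ ℂ ⧸ vanishingIdeal ℂ (cone V)) :=
    Ideal.Quotient.nontrivial_iff.mpr vanishingIdeal_cone_ne_top
  have hnonneg : 0 ≤ coneDim V := ringKrullDim_nonneg_of_nontrivial
  obtain ⟨d, hd⟩ := WithBot.ne_bot_iff_exists.mp (ne_bot_of_le_ne_bot WithBot.zero_ne_bot hnonneg)
  have hle : (d : WithBot ℕ∞) ≤ (Fintype.card σ : ℕ∞) := hd.trans_le (coneDim_le_card V)
  obtain ⟨n, rfl⟩ := ENat.ne_top_iff_exists.mp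
    (ne_top_of_le_ne_top (ENat.natCast_ne_top _) (WithBot.coe_le_coe.mp hle))
  exact ⟨n, hd.symm⟩

theorem coneDim_empty : coneDim (∅ : Set (PSpace σ)) = 0 := by
  have hcone : cone (∅ : Set (PSpace σ)) = {0} := by
    ext v
    simp [cone]
  rw [coneDim, hcone]
  let := Ideal.Quotient.field (vanishingIdeal ℂ ({0} : Set (σ → ℂ)))
  exact ringKrullDim_eq_zero_of_field _

theorem HasDim.nonempty {D : ℕ} (hV : HasDim V D) : V.Nonempty := by
  rw [Set.nonempty_iff_ne_empty]
  rintro rfl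
  rw [HasDim, coneDim_empty] at hV
  exact absurd hV (by norm_cast)

theorem HasDim.lt_card [Fintype σ] {D : ℕ} (hV : HasDim V D) : D < Fintype.card σ := by
  have hle := hV ▸ coneDim_le_card V
  exact_mod_cast hle

theorem coneDim_add_one_le (hV : IsProjClosed V) (hVZ : V ⊂ Z)
    (hZ : (vanishingIdeal ℂ (cone Z)).IsPrime) : coneDim V + 1 ≤ coneDim Z := by
  have hle := vanishingIdeal_anti_mono (K := ℂ) (k := ℂ) (cone_subset_cone.mpr hVZ.subset)
  obtain ⟨f, hfV, hfZ⟩ := SetLike.not_le_iff_exists.mp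
    (mt hV.vanishingIdeal_le_iff.mp hVZ.not_subset)
  have : IsDomain (MvPolynomial σ ℂ ⧸ vanishingIdeal ℂ (cone Z)) :=
    (Ideal.Quotient.isDomain_iff_prime _).mpr hZ
  refine ringKrullDim_succ_le_of_surjective (Ideal.Quotient.factor hle)
    (Ideal.Quotient.factor_surjective hle) (r := Ideal.Quotient.mk _ f) ?_ ?_
  · rwa [mem_nonZeroDivisors_iff_ne_zero, Ne, Ideal.Quotient.eq_zero_iff_mem]
  · rwa [Ideal.Quotient.factor_mk, Ideal.Quotient.eq_zero_iff_mem]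

end Dimension

/-! ### Hyperplane sections -/

section PrimeAvoidance

variable {K A M : Type*} [Field K] [Infinite K] [CommRing A] [Algebra K A] [IsNoetherianRing A]
  [AddCommGroup M] [Module K M]

theorem exists_forall_minimalPrimes_notMem (f : M →ₗ[K] A) (J : Ideal A) :
    ∃ m, ∀ Q ∈ J.minimalPrimes, f m ∈ Q → ∀ x, f x ∈ Q := by
  classical
  have hfin : J.minimalPrimes.Finite := J.finite_minimalPrimes_of_isNoetherianRing
  let preimages : Finset (Submodule K M) :=
    hfin.toFinset.image fun Q => (Q.restrictScalars K).comap f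
  obtain ⟨m, hm⟩ := (Set.ne_univ_iff_exists_notMem _).mp <|
    Subspace.biUnion_ne_univ_of_top_notMem (s := preimages.filter (· ≠ ⊤)) (by simp)
  refine ⟨m, fun Q hQ hmQ => ?_⟩
  by_contra hne
  refine hm (Set.mem_biUnion (x := (Q.restrictScalars K).comap f) ?_ hmQ)
  refine Finset.mem_coe.mpr (Finset.mem_filter.mpr ⟨Finset.mem_image.mpr
    ⟨Q, hfin.mem_toFinset.mpr hQ, rfl⟩, fun htop => hne fun x => ?_⟩)
  exact (Submodule.eq_top_iff'.mp htop x :)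

theorem exists_forall_isPrime_le_height (f : M →ₗ[K] A) (j : ℕ) :
    ∃ a : Fin j → M, ∀ P : Ideal A, P.IsPrime → (∀ k, f (a k) ∈ P) →
      (∀ x, f x ∈ P) ∨ (j : ℕ∞) ≤ P.height := by
  induction j with
  | zero => exact ⟨Fin.elim0, fun P _ _ => Or.inr (by simp)⟩
  | succ j ih =>
    obtain ⟨a, ha⟩ := ih
    let J := Ideal.span (Set.range fun k => f (a k))
    obtain ⟨m, hm⟩ := exists_forall_minimalPrimes_notMem f J
    refine ⟨Fin.snoc a m, fun P hP hPa => ?_⟩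
    have haP : ∀ k, f (a k) ∈ P := fun k => by simpa using hPa k.castSucc
    have hmP : f m ∈ P := by simpa using hPa (Fin.last j)
    obtain ⟨Q, hQ, hQP⟩ := Ideal.exists_minimalPrimes_le
      (Ideal.span_le.mpr (Set.range_subset_iff.mpr haP) : J ≤ P)
    have hQprime : Q.IsPrime := hQ.1.1
    by_cases hmQ : f m ∈ Q
    · exact Or.inl fun x => hQP (hm Q hQ hmQ x)
    have hheight : (j : ℕ∞) ≤ Q.height :=
      (ha Q hQprime fun k => hQ.1.2 (Ideal.subset_span ⟨k, rfl⟩)).resolve_left fun h => hmQ (h m)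
    have hlt : Q < P := lt_of_le_of_ne hQP fun h => hmQ (h ▸ hmP)
    refine Or.inr ?_
    push_cast
    exact (add_le_add_left hheight 1).trans (Ideal.height_add_one_le_of_lt_of_isPrime hlt)

end PrimeAvoidance

section HyperplaneSections

variable {σ : Type} {Z : Set (PSpace σ)}

theorem exists_isPrime_mem_iff_forall_eval_smul {v : σ → ℂ} (hv : v ∈ cone Z) (hv0 : v ≠ 0) :
    ∃ P : Ideal (MvPolynomial σ ℂ ⧸ vanishingIdeal ℂ (cone Z)), P.IsPrime ∧
      (P.height : WithBot ℕ∞) + 1 ≤ coneDim Z ∧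
      ∀ f, Ideal.Quotient.mk _ f ∈ P ↔ ∀ t : ℂ, eval (t • v) f = 0 := by
  let φ : MvPolynomial σ ℂ ⧸ vanishingIdeal ℂ (cone Z) →ₐ[ℂ] Polynomial ℂ :=
    Ideal.Quotient.liftₐ _ (restrictLine 0 v) fun f hf => Polynomial.funext fun t => by
      rw [eval_restrictLine, zero_add, Polynomial.eval_zero]
      exact hf _ (smul_mem_cone hv t)
  have heval (f) (t : ℂ) : (φ (Ideal.Quotient.mk _ f)).eval t = eval (t • v) f := by
    rw [← zero_add (t • v), ← eval_restrictLine]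
    rfl
  let P := RingHom.ker φ
  let m := RingHom.ker ((Polynomial.evalRingHom (0 : ℂ)).comp φ.toRingHom)
  have hP (f) : Ideal.Quotient.mk _ f ∈ P ↔ ∀ t : ℂ, eval (t • v) f = 0 := by
    simp only [P, RingHom.mem_ker, ← heval]
    exact ⟨fun h t => by rw [h, Polynomial.eval_zero],
      fun h => Polynomial.funext fun t => by rw [h, Polynomial.eval_zero]⟩
  have hm (f) : Ideal.Quotient.mk _ f ∈ m ↔ eval 0 f = 0 := by
    rw [← zero_smul ℂ v, ← heval]
    rfl
  have hPprime : P.IsPrime := RingHom.ker_isPrime _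
  have hmprime : m.IsPrime := RingHom.ker_isPrime _
  refine ⟨P, hPprime, ?_, hP⟩
  obtain ⟨j, hj⟩ := Function.ne_iff.mp hv0
  have hlt : P < m := by
    refine lt_of_le_of_ne (fun x hx => ?_) fun heq => hj ?_
    · obtain ⟨f, rfl⟩ := Ideal.Quotient.mk_surjective x
      simpa [hm] using (hP f).mp hx 0
    · simpa using (hP (X j)).mp (heq ▸ (hm (X j)).mpr (by simp)) 1
  calc (P.height : WithBot ℕ∞) + 1 ≤ m.height := by
        exact_mod_cast Ideal.height_add_one_le_of_lt_of_isPrime hlt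
    _ ≤ coneDim Z := Ideal.height_le_ringKrullDim_of_ne_top hmprime.ne_top

theorem exists_forall_mem_exists_dotProduct_ne_zero [Fintype σ] {E : Submodule ℂ (σ → ℂ)}
    (hE : ∀ v ∈ cone Z, v ≠ 0 → ∃ a ∈ E, a ⬝ᵥ v ≠ 0) {k : ℕ} (hk : coneDim Z ≤ k) :
    ∃ ξ : Fin k → σ → ℂ, (∀ i, ξ i ∈ E) ∧ ∀ v ∈ cone Z, v ≠ 0 → ∃ i, ξ i ⬝ᵥ v ≠ 0 := by
  let linearForm : (σ → ℂ) →ₗ[ℂ] MvPolynomial σ ℂ := Fintype.linearCombination ℂ X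
  have heval (a v) : eval v (linearForm a) = a ⬝ᵥ v := by
    simp [linearForm, Fintype.linearCombination_apply, dotProduct]
  obtain ⟨ξ, hξ⟩ := exists_forall_isPrime_le_height
    ((Ideal.Quotient.mkₐ ℂ (vanishingIdeal ℂ (cone Z))).toLinearMap ∘ₗ linearForm ∘ₗ E.subtype) k
  refine ⟨fun i => ξ i, fun i => (ξ i).2, fun v hv hv0 => ?_⟩
  obtain ⟨P, hP, hheight, hmem⟩ := exists_isPrime_mem_iff_forall_eval_smul hv hv0
  by_contra! hξv
  rcases hξ P hP fun i => (hmem _).mpr fun t => by simp [heval, hξv] with hall | hle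
  · obtain ⟨a, haE, hav⟩ := hE v hv hv0
    exact hav (by simpa [heval] using (hmem _).mp (hall ⟨a, haE⟩) 1)
  · have hlt : (k : WithBot ℕ∞) + 1 ≤ k :=
      (add_le_add_left (WithBot.coe_le_coe.mpr hle) 1).trans (hheight.trans hk)
    have : k + 1 ≤ k := by exact_mod_cast hlt
    lia

theorem exists_forall_exists_dotProduct_ne_zero [Fintype σ] {k : ℕ} (hk : coneDim Z ≤ k) :
    ∃ ξ : Fin k → σ → ℂ, ∀ v ∈ cone Z, v ≠ 0 → ∃ i, ξ i ⬝ᵥ v ≠ 0 := by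
  classical
  refine (exists_forall_mem_exists_dotProduct_ne_zero (E := ⊤) (fun v _ hv0 => ?_) hk).imp
    fun ξ hξ => hξ.2
  obtain ⟨j, hj⟩ := Function.ne_iff.mp hv0
  exact ⟨Pi.single j 1, trivial, by simpa using hj⟩

theorem exists_dotProduct_eq_zero_of_notMem_cone [Fintype σ] {p : σ → ℂ} (hp : p ∉ cone Z) {k : ℕ}
    (hk : coneDim Z ≤ k) : ∃ ξ : Fin k → σ → ℂ, (∀ i, ξ i ⬝ᵥ p = 0) ∧
      ∀ v ∈ cone Z, v ≠ 0 → ∃ i, ξ i ⬝ᵥ v ≠ 0 := by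
  classical
  suffices ∀ v ∈ cone Z, v ≠ 0 → ∃ a ∈ LinearMap.ker (dotProductEquiv ℂ σ p), a ⬝ᵥ v ≠ 0 by
    obtain ⟨ξ, hξp, hξ⟩ := exists_forall_mem_exists_dotProduct_ne_zero this hk
    exact ⟨ξ, fun i => (dotProduct_comm _ _).trans (hξp i), hξ⟩
  intro v hv hv0
  by_contra! hperp
  have hspan : dotProductEquiv ℂ σ v ∈
      Submodule.span ℂ (Set.range fun _ : Unit => dotProductEquiv ℂ σ p) :=
    mem_span_of_iInf_ker_le_ker (by
      rw [iInf_const]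
      exact fun a ha => (dotProduct_comm _ _).trans (hperp a ha))
  rw [Set.range_const, Submodule.mem_span_singleton] at hspan
  obtain ⟨c, hc⟩ := hspan
  rw [← map_smul, (dotProductEquiv ℂ σ).injective.eq_iff] at hc
  have hc0 : c ≠ 0 := fun h => hv0 (by rw [← hc, h, zero_smul])
  have hmem := smul_mem_cone (hc ▸ hv) c⁻¹
  rw [inv_smul_smul₀ hc0] at hmem
  exact hp hmem

end HyperplaneSections

/-! ### Linear sections and pencils of hyperplanes -/

section LinearSections

variable {κ σ : Type} [Fintype σ]

/-- The vectors on which all the linear forms with coefficient vectors `ζ k` vanish. -/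
def commonKernel (ζ : κ → σ → ℂ) : Submodule ℂ (σ → ℂ) :=
  LinearMap.ker (Matrix.of ζ).mulVecLin

theorem mem_commonKernel {ζ : κ → σ → ℂ} {v : σ → ℂ} :
    v ∈ commonKernel ζ ↔ ∀ k, ζ k ⬝ᵥ v = 0 := by
  rw [commonKernel, LinearMap.mem_ker, Matrix.mulVecLin_apply, funext_iff]
  rfl

theorem mem_linearSubspace_commonKernel {ζ : κ → σ → ℂ} {p : PSpace σ} :
    p ∈ linearSubspace (commonKernel ζ) ↔ ∀ k, ζ k ⬝ᵥ p.rep = 0 :=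
  mem_commonKernel

variable [Fintype κ]

theorem finrank_commonKernel {ζ : κ → σ → ℂ} (hζ : LinearIndependent ℂ ζ) :
    Module.finrank ℂ (commonKernel ζ) + Fintype.card κ = Fintype.card σ := by
  have hrank : Module.finrank ℂ (Matrix.of ζ).mulVecLin.range = Fintype.card κ :=
    LinearIndependent.rank_matrix (M := Matrix.of ζ) hζ
  rw [add_comm, ← hrank, commonKernel, LinearMap.finrank_range_add_finrank_ker,
    Module.finrank_fintype_fun_eq_card]

theorem exists_commonKernel_eq {L : Submodule ℂ (σ → ℂ)}
    (hL : Module.finrank ℂ L + Fintype.card κ = Fintype.card σ) :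
    ∃ ζ : κ → σ → ℂ, commonKernel ζ = L := by
  classical
  have hquot := Submodule.finrank_quotient_add_finrank L
  rw [Module.finrank_fintype_fun_eq_card] at hquot
  let e : ((σ → ℂ) ⧸ L) ≃ₗ[ℂ] (κ → ℂ) := LinearEquiv.ofFinrankEq _ _ (by
    rw [Module.finrank_fintype_fun_eq_card]
    lia)
  refine ⟨Matrix.of.symm (LinearMap.toMatrix' (e.toLinearMap ∘ₗ L.mkQ)), ?_⟩
  rw [commonKernel, Equiv.apply_symm_apply, ← Matrix.toLin'_apply', Matrix.toLin'_toMatrix',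
    LinearEquiv.ker_comp, Submodule.ker_mkQ]

end LinearSections

section Pencils

variable {σ : Type} [Fintype σ]

theorem exists_forall_dotProduct_ne_zero {ι : Type*} [Finite ι] {v : ι → σ → ℂ}
    (hv : ∀ i, v i ≠ 0) : ∃ u : σ → ℂ, ∀ i, u ⬝ᵥ v i ≠ 0 := by
  classical
  obtain ⟨f, hf⟩ := Module.exists_dual_forall_apply_ne_zero (K := ℂ) v hv
  obtain ⟨u, rfl⟩ := (dotProductEquiv ℂ σ).surjective f
  exact ⟨u, hf⟩

/-- The parameter `s` of the member `u + s • w` of a pencil of hyperplanes which contains the point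
`p`; meaningful when `w` does not contain `p`. -/
def pencilParam (u w : σ → ℂ) (p : PSpace σ) : ℂ :=
  -(u ⬝ᵥ p.rep / w ⬝ᵥ p.rep)

theorem add_smul_dotProduct_rep_eq_zero_iff {u w : σ → ℂ} {p : PSpace σ} (hw : w ⬝ᵥ p.rep ≠ 0)
    {s : ℂ} : (u + s • w) ⬝ᵥ p.rep = 0 ↔ pencilParam u w p = s := by
  rw [add_dotProduct, smul_dotProduct, smul_eq_mul, pencilParam, neg_eq_iff_eq_neg, div_eq_iff hw,
    neg_mul, ← add_eq_zero_iff_eq_neg]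

theorem exists_injOn_pencilParam {T : Set (PSpace σ)} (hT : T.Finite) {w : σ → ℂ}
    (hw : ∀ p ∈ T, w ⬝ᵥ p.rep ≠ 0) : ∃ u, Set.InjOn (pencilParam u w) T := by
  have := hT.to_subtype
  obtain ⟨u, hu⟩ := exists_forall_dotProduct_ne_zero (ι := {pq : T × T // pq.1 ≠ pq.2})
    (v := fun pq => (w ⬝ᵥ pq.1.2.1.rep) • pq.1.1.1.rep - (w ⬝ᵥ pq.1.1.1.rep) • pq.1.2.1.rep) (by
      rintro ⟨⟨p, q⟩, hpq⟩ h
      refine hpq (Subtype.ext ?_)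
      rw [← (p : PSpace σ).mk_rep, ← (q : PSpace σ).mk_rep, Projectivization.mk_eq_mk_iff']
      refine ⟨(w ⬝ᵥ (q : PSpace σ).rep)⁻¹ * w ⬝ᵥ (p : PSpace σ).rep, ?_⟩
      rw [mul_smul, ← sub_eq_zero.mp h, inv_smul_smul₀ (hw q q.2)])
  refine ⟨u, fun p hp q hq hpq => ?_⟩
  by_contra hne
  apply hu ⟨(⟨p, hp⟩, ⟨q, hq⟩), by simpa using hne⟩
  rw [pencilParam, pencilParam, neg_inj, div_eq_div_iff (hw p hp) (hw q hq)] at hpq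
  simp only [dotProduct_sub, dotProduct_smul, smul_eq_mul]
  linear_combination hpq

end Pencils

/-! ### Chow forms -/

section ChowForm

open Function (uncurry update update_self update_of_ne)

variable {σ : Type} [Fintype σ] {V : Set (PSpace σ)} {D : ℕ}
  {F : MvPolynomial (Fin (D + 1) × σ) ℂ}

theorem IsChowForm.exists_isRowHomogeneous (hF : IsChowForm V F) :
    ∃ e : Fin (D + 1) → ℕ, ∀ i, IsRowHomogeneous F i (e i) :=
  Classical.skolem.mp hF.multihomogeneous

theorem IsChowForm.eval_eq_zero_iff_of_forall_ne_zero (hF : IsChowForm V F)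
    {ξ : Fin (D + 1) → σ → ℂ} (hξ : ∀ i, ξ i ≠ 0) :
    eval (uncurry ξ) F = 0 ↔ ∃ v ∈ cone V, v ≠ 0 ∧ ∀ i, ξ i ⬝ᵥ v = 0 :=
  (hF.eval_eq_zero_iff ξ hξ).trans <|
    exists_rep_iff (P := fun v => ∀ i, ξ i ⬝ᵥ v = 0) fun c v hv i => by
      rw [dotProduct_smul, hv, smul_zero]

theorem IsChowForm.exists_mem_cone_forall_dotProduct_eq_zero (hF : IsChowForm V F)
    (ζ : Fin D → σ → ℂ) : ∃ v ∈ cone V, v ≠ 0 ∧ ∀ k, ζ k ⬝ᵥ v = 0 := by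
  wlog hζ : ∀ k, ζ k ≠ 0 generalizing ζ with hnonzero
  · let ζ' := fun k => if ζ k = 0 then 1 else ζ k
    have hpos := Nat.zero_lt_of_lt hF.hasDim.lt_card
    have : Nonempty σ := Fintype.card_pos_iff.mp hpos
    obtain ⟨v, hv, hv0, h⟩ := hnonzero ζ' fun k => by
      by_cases hk : ζ k = 0 <;> simp [ζ', hk]
    refine ⟨v, hv, hv0, fun k => ?_⟩
    by_cases hk : ζ k = 0
    · rw [hk, zero_dotProduct]
    · simpa [ζ', hk] using h k
  have hcard := hF.hasDim.lt_card
  cases subsingleton_or_nontrivial σ with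
  | inl hσ =>
    obtain ⟨p, hp⟩ := hF.hasDim.nonempty
    obtain rfl : D = 0 := by
      have := Fintype.card_le_one_iff_subsingleton.mpr hσ
      lia
    exact ⟨p.rep, rep_mem_cone_iff.mpr hp, p.rep_nonzero, isEmptyElim⟩
  | inr hσ =>
    obtain ⟨e, he⟩ := hF.exists_isRowHomogeneous
    obtain ⟨j, hj⟩ := exists_rowDegree_ne_zero hF.irreducible he
    obtain ⟨u, hu, hFu⟩ := (he j).exists_ne_zero_eval_update_eq_zero hj (j.insertNth 0 ζ)
    rw [Fin.update_insertNth, hF.eval_eq_zero_iff_of_forall_ne_zero] at hFu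
    · obtain ⟨v, hv, hv0, hvξ⟩ := hFu
      exact ⟨v, hv, hv0, fun k => by simpa using hvξ (j.succAbove k)⟩
    · simpa [Fin.forall_iff_succAbove j] using ⟨hu, hζ⟩

theorem IsChowForm.exists_forall_ne_zero_and_eval_ne_zero (hF : IsChowForm V F) :
    ∃ ξ : Fin (D + 1) → σ → ℂ, (∀ i, ξ i ≠ 0) ∧ eval (uncurry ξ) F ≠ 0 := by
  obtain ⟨ξ, hξ⟩ := exists_forall_exists_dotProduct_ne_zero (k := D + 1)
    (by exact_mod_cast hF.hasDim.le)
  have hne (i) : ξ i ≠ 0 := by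
    intro hi
    obtain ⟨v, hv, hv0, h⟩ := hF.exists_mem_cone_forall_dotProduct_eq_zero (i.removeNth ξ)
    obtain ⟨k, hk⟩ := hξ v hv hv0
    exact hk ((Fin.forall_iff_succAbove i (P := fun k => ξ k ⬝ᵥ v = 0)).mpr
      ⟨by rw [hi, zero_dotProduct], h⟩ k)
  refine ⟨ξ, hne, ?_⟩
  rw [Ne, hF.eval_eq_zero_iff_of_forall_ne_zero hne]
  rintro ⟨v, hv, hv0, h⟩
  obtain ⟨k, hk⟩ := hξ v hv hv0
  exact hk (h k)

/-- A group of variables not occurring in `F` could be given the values of another, occurring one,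
and then the `D + 1` hyperplanes would again have a common point on `V`. -/
theorem IsChowForm.rowDegree_ne_zero (hF : IsChowForm V F) {i : Fin (D + 1)} {e : ℕ}
    (he : IsRowHomogeneous F i e) : e ≠ 0 := by
  rintro rfl
  obtain ⟨d, hd⟩ := hF.exists_isRowHomogeneous
  obtain ⟨j, hj⟩ := exists_rowDegree_ne_zero hF.irreducible hd
  have hji : j ≠ i := by
    rintro rfl
    exact hj ((hd j).inj_right hF.irreducible.ne_zero he)
  obtain ⟨ξ, hξ, hFξ⟩ := hF.exists_forall_ne_zero_and_eval_ne_zero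
  have hconst (u : σ → ℂ) : eval (uncurry (update ξ i u)) F = eval (uncurry ξ) F := by
    have hu := he.eval_update_smul (update ξ i u) 0
    have hξ := he.eval_update_smul ξ 0
    rw [Function.update_idem] at hu
    rw [zero_smul, pow_zero, one_mul] at hu hξ
    rw [← hu, hξ]
  obtain ⟨v, hv, hv0, hvξ⟩ := hF.exists_mem_cone_forall_dotProduct_eq_zero (i.removeNth ξ)
  obtain ⟨j, rfl⟩ := Fin.exists_succAbove_eq hji
  rw [← hconst (ξ (i.succAbove j)), Ne, hF.eval_eq_zero_iff_of_forall_ne_zero] at hFξ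
  · refine hFξ ⟨v, hv, hv0, (Fin.forall_iff_succAbove i).mpr ⟨?_, fun k => ?_⟩⟩
    · rw [update_self]
      exact hvξ j
    · rw [update_of_ne (i.succAbove_ne k)]
      exact hvξ k
  · exact (Fin.forall_iff_succAbove i).mpr ⟨by simpa using hξ _, fun k => by simpa using hξ _⟩

theorem IsChowForm.eval_eq_zero_iff_exists_mem_cone (hF : IsChowForm V F)
    {ξ : Fin (D + 1) → σ → ℂ} :
    eval (uncurry ξ) F = 0 ↔ ∃ v ∈ cone V, v ≠ 0 ∧ ∀ i, ξ i ⬝ᵥ v = 0 := by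
  by_cases hξ : ∀ i, ξ i ≠ 0
  · exact hF.eval_eq_zero_iff_of_forall_ne_zero hξ
  push Not at hξ
  obtain ⟨i, hi⟩ := hξ
  obtain ⟨e, he⟩ := hF.exists_isRowHomogeneous
  have hzero := (he i).eval_update_smul ξ 0
  rw [zero_pow (hF.rowDegree_ne_zero (he i)), zero_mul, zero_smul, ← hi, Function.update_eq_self]
    at hzero
  obtain ⟨v, hv, hv0, hvξ⟩ := hF.exists_mem_cone_forall_dotProduct_eq_zero (i.removeNth ξ)
  exact iff_of_true hzero
    ⟨v, hv, hv0, (Fin.forall_iff_succAbove i).mpr ⟨by rw [hi, zero_dotProduct], hvξ⟩⟩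

theorem IsChowForm.linearIndependent_of_eval_ne_zero (hF : IsChowForm V F)
    {ξ : Fin (D + 1) → σ → ℂ} (hξ : eval (uncurry ξ) F ≠ 0) : LinearIndependent ℂ ξ := by
  classical
  rw [linearIndependent_iff_notMem_span]
  intro i hi
  obtain ⟨v, hv, hv0, hvξ⟩ := hF.exists_mem_cone_forall_dotProduct_eq_zero (i.removeNth ξ)
  have hspan : Submodule.span ℂ (ξ '' (Set.univ \ {i})) ≤
      LinearMap.ker (dotProductEquiv ℂ σ v) := by
    rw [Submodule.span_le]
    rintro _ ⟨k, ⟨-, hk⟩, rfl⟩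
    obtain ⟨k, rfl⟩ := Fin.exists_succAbove_eq hk
    exact (dotProduct_comm _ _).trans (hvξ k)
  refine hξ (hF.eval_eq_zero_iff_exists_mem_cone.mpr ⟨v, hv, hv0,
    (Fin.forall_iff_succAbove i).mpr ⟨(dotProduct_comm _ _).trans (hspan hi), hvξ⟩⟩)

end ChowForm

/-! ### The degree of a Chow form in each group of variables -/

section Degree

open Function (uncurry update)

variable {σ : Type} [Fintype σ] {V : Set (PSpace σ)} {D : ℕ}
  {F : MvPolynomial (Fin (D + 1) × σ) ℂ} {i : Fin (D + 1)} {e : ℕ} {ζ : Fin D → σ → ℂ} {w : σ → ℂ}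

theorem IsChowForm.eval_insertNth_eq_zero_iff (hF : IsChowForm V F) :
    eval (uncurry (i.insertNth w ζ)) F = 0 ↔
      ∃ p ∈ V ∩ linearSubspace (commonKernel ζ), w ⬝ᵥ p.rep = 0 := by
  rw [hF.eval_eq_zero_iff_exists_mem_cone,
    ← exists_rep_iff (P := fun v => ∀ k, i.insertNth (α := fun _ => σ → ℂ) w ζ k ⬝ᵥ v = 0)
      fun c v hv k => by rw [dotProduct_smul, hv, smul_zero]]
  simp only [Fin.forall_iff_succAbove i, Fin.insertNth_apply_same, Fin.insertNth_apply_succAbove,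
    Set.mem_inter_iff, mem_linearSubspace_commonKernel, and_assoc,
    and_comm (a := w ⬝ᵥ Projectivization.rep _ = 0)]

theorem IsChowForm.isRoot_restrictLine_insertNth_iff (hF : IsChowForm V F)
    (hw : eval (uncurry (i.insertNth w ζ)) F ≠ 0) {u : σ → ℂ} {s : ℂ} :
    (restrictLine (uncurry (i.insertNth u ζ)) (uncurry (Pi.single i w)) F).IsRoot s ↔
      s ∈ pencilParam u w '' (V ∩ linearSubspace (commonKernel ζ)) := by
  rw [Polynomial.IsRoot, eval_restrictLine, uncurry_add_smul_single, Fin.insertNth_apply_same,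
    Fin.update_insertNth, hF.eval_insertNth_eq_zero_iff]
  refine exists_congr fun p => and_congr_right fun hp => add_smul_dotProduct_rep_eq_zero_iff ?_
  exact fun hwp => hw (hF.eval_insertNth_eq_zero_iff.mpr ⟨p, hp, hwp⟩)

theorem IsChowForm.rootSet_restrictLine_insertNth (hF : IsChowForm V F)
    (hw : eval (uncurry (i.insertNth w ζ)) F ≠ 0) (u : σ → ℂ) :
    (restrictLine (uncurry (i.insertNth u ζ)) (uncurry (Pi.single i w)) F).rootSet ℂ =
      pencilParam u w '' (V ∩ linearSubspace (commonKernel ζ)) := by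
  obtain ⟨e, he⟩ := hF.exists_isRowHomogeneous
  ext s
  rw [← hF.isRoot_restrictLine_insertNth_iff hw, Polynomial.mem_rootSet_of_ne,
    Polynomial.coe_aeval_eq_eval, Polynomial.IsRoot]
  intro h0
  apply hw
  have := ((he i).restrictLine_natDegree_le_and_coeff (i.insertNth u ζ) w).2
  rwa [h0, Polynomial.coeff_zero, Fin.update_insertNth, eq_comm] at this

theorem IsChowForm.encard_inter_linearSubspace_le (hF : IsChowForm V F)
    (he : IsRowHomogeneous F i e) (hw : eval (uncurry (i.insertNth w ζ)) F ≠ 0) :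
    (V ∩ linearSubspace (commonKernel ζ)).encard ≤ e := by
  by_contra! hlt
  obtain ⟨T, hT, hcard⟩ := Set.exists_subset_encard_eq (Order.add_one_le_of_lt hlt)
  obtain ⟨u, hu⟩ := exists_injOn_pencilParam (w := w) (T := T)
    (Set.finite_of_encard_eq_coe (k := e + 1) hcard)
    fun p hp hwp => hw (hF.eval_insertNth_eq_zero_iff.mpr ⟨p, hT hp, hwp⟩)
  have hle := Polynomial.ncard_rootSet_le
    (restrictLine (uncurry (i.insertNth u ζ)) (uncurry (Pi.single i w)) F) ℂ
  rw [he.natDegree_restrictLine_insertNth hw] at hle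
  have hTle := Set.encard_le_encard (Set.image_mono (f := pencilParam u w) hT)
  rw [← hF.rootSet_restrictLine_insertNth hw, hu.encard_image, hcard,
    ← (Polynomial.rootSet_finite _ ℂ).cast_ncard_eq] at hTle
  norm_cast at hTle
  lia

theorem IsChowForm.exists_ncard_inter_linearSubspace_eq (hF : IsChowForm V F)
    (he : IsRowHomogeneous F i e) : ∃ ζ : Fin D → σ → ℂ, LinearIndependent ℂ ζ ∧
      (V ∩ linearSubspace (commonKernel ζ)).Finite ∧
      (V ∩ linearSubspace (commonKernel ζ)).ncard = e := by
  obtain ⟨ξ, -, hξ⟩ := hF.exists_forall_ne_zero_and_eval_ne_zero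
  rw [← i.insertNth_self_removeNth ξ] at hξ
  have hdeg := he.natDegree_restrictLine_insertNth hξ (ξ i)
  obtain ⟨x, hsep, hle⟩ := exists_separable_restrictLine hF.irreducible
    (hdeg.trans_ne (hF.rowDegree_ne_zero he))
  obtain ⟨u, ζ, rfl⟩ : ∃ u ζ, uncurry (i.insertNth (α := fun _ => σ → ℂ) u ζ) = x :=
    ⟨Function.curry x i, i.removeNth (Function.curry x), by
      rw [i.insertNth_self_removeNth, Function.uncurry_curry]⟩
  obtain ⟨hge, hcoeff⟩ := he.restrictLine_natDegree_le_and_coeff (i.insertNth u ζ) (ξ i)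
  replace hdeg := hge.antisymm (hdeg.ge.trans hle)
  have hw : eval (uncurry (i.insertNth (ξ i) ζ)) F ≠ 0 := by
    rw [Fin.update_insertNth, ← hdeg, Polynomial.coeff_natDegree] at hcoeff
    exact hcoeff ▸ Polynomial.leadingCoeff_ne_zero.mpr hsep.ne_zero
  have hroots := Polynomial.card_rootSet_eq_natDegree (K := ℂ) hsep (IsAlgClosed.splits _)
  rw [hdeg, ← Nat.card_eq_fintype_card, Nat.card_coe_set_eq,
    hF.rootSet_restrictLine_insertNth hw] at hroots
  have hupper := hF.encard_inter_linearSubspace_le he hw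
  have hfin := Set.finite_of_encard_le_coe hupper
  have hindep := hF.linearIndependent_of_eval_ne_zero hw
  refine ⟨ζ, ?_, hfin, le_antisymm ?_ (hroots ▸ Set.ncard_image_le hfin)⟩
  · simpa [Function.comp_def] using hindep.comp i.succAbove Fin.succAbove_right_injective
  · rw [← hfin.cast_ncard_eq] at hupper
    exact_mod_cast hupper

theorem IsChowForm.isRowHomogeneous_degree (hF : IsChowForm V F) (i : Fin (D + 1)) :
    IsRowHomogeneous F i (degree V) := by
  obtain ⟨e, he⟩ := hF.multihomogeneous i
  have hcodim (L : Submodule ℂ (σ → ℂ)) :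
      (Module.finrank ℂ L : WithBot ℕ∞) + coneDim V = (Fintype.card σ : WithBot ℕ∞) + 1 ↔
        Module.finrank ℂ L + Fintype.card (Fin D) = Fintype.card σ := by
    rw [hF.hasDim, ← add_assoc, Fintype.card_fin]
    norm_cast
    lia
  suffices IsGreatest {m : ℕ | ∃ L : Submodule ℂ (σ → ℂ),
      (Module.finrank ℂ L : WithBot ℕ∞) + coneDim V = (Fintype.card σ : WithBot ℕ∞) + 1 ∧
      (V ∩ linearSubspace L).Finite ∧ (V ∩ linearSubspace L).ncard = m} e by
    rw [degree, this.csSup_eq]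
    exact he
  constructor
  · obtain ⟨ζ, hζ, hfin, hcard⟩ := hF.exists_ncard_inter_linearSubspace_eq he
    exact ⟨_, (hcodim _).mpr (finrank_commonKernel hζ), hfin, hcard⟩
  · rintro _ ⟨L, hL, hfin, rfl⟩
    obtain ⟨ζ, rfl⟩ := exists_commonKernel_eq ((hcodim L).mp hL)
    have := hfin.to_subtype
    obtain ⟨w, hw⟩ := exists_forall_dotProduct_ne_zero
      (v := fun p : ↥(V ∩ linearSubspace (commonKernel ζ)) => (p : PSpace σ).rep)
      fun p => (p : PSpace σ).rep_nonzero
    have hne : eval (uncurry (i.insertNth w ζ)) F ≠ 0 :=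
      mt hF.eval_insertNth_eq_zero_iff.mp fun ⟨p, hp, hwp⟩ => hw ⟨p, hp⟩ hwp
    have hle := hF.encard_inter_linearSubspace_le he hne
    rw [← hfin.cast_ncard_eq] at hle
    exact_mod_cast hle

theorem IsChowForm.degree_ne_zero (hF : IsChowForm V F) : degree V ≠ 0 :=
  hF.rowDegree_ne_zero (hF.isRowHomogeneous_degree 0)

end Degree

/-! ### Joins with a projective space -/

section Join

variable {σ τ : Type}

theorem mem_cone_join_univ {W : Set (PSpace τ)} {v : σ ⊕ τ → ℂ} :
    v ∈ cone (join (Set.univ : Set (PSpace σ)) W) ↔ v ∘ Sum.inr ∈ cone W := by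
  by_cases hv : v = 0
  · subst hv
    exact ⟨fun _ => zero_mem_cone, fun _ => zero_mem_cone⟩
  rw [← mk_mem_iff hv]
  constructor
  · rintro ⟨y, -, w, hw, h, heq⟩
    obtain ⟨a, rfl⟩ := (Projectivization.mk_eq_mk_iff' ℂ _ _ _ _).mp heq
    exact smul_mem_cone hw a
  · intro h
    have hsplit : Sum.elim (v ∘ Sum.inl) (v ∘ Sum.inr) = v := Sum.elim_comp_inl_inr v
    exact ⟨v ∘ Sum.inl, fun _ => Set.mem_univ _, v ∘ Sum.inr, h, by rwa [hsplit],
      by simp only [hsplit]⟩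

theorem mem_cone_embR_preimage {V : Set (PSpace (σ ⊕ τ))} {w : τ → ℂ} :
    w ∈ cone (embR σ τ ⁻¹' V) ↔ Sum.elim (0 : σ → ℂ) w ∈ cone V := by
  by_cases hw : w = 0
  · rw [hw, Sum.elim_zero_zero]
    exact ⟨fun _ => zero_mem_cone, fun _ => zero_mem_cone⟩
  have hne : (Sum.elim 0 w : σ ⊕ τ → ℂ) ≠ 0 := fun h => hw (congrArg (· ∘ Sum.inr) h)
  rw [← mk_mem_iff hw, ← mk_mem_iff hne]
  rfl

theorem mem_cone_embR_image {X : Set (PSpace τ)} {v : σ ⊕ τ → ℂ} :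
    v ∈ cone (embR σ τ '' X) ↔ v ∘ Sum.inl = 0 ∧ v ∘ Sum.inr ∈ cone X := by
  constructor
  · intro hv
    by_cases hv0 : v = 0
    · subst hv0
      exact ⟨rfl, zero_mem_cone⟩
    obtain ⟨p, hp, hpv⟩ := hv hv0
    rw [embR, ← p.mk_rep, Projectivization.map_mk] at hpv
    obtain ⟨a, rfl⟩ := (Projectivization.mk_eq_mk_iff' ℂ _ _ _ _).mp hpv.symm
    exact ⟨funext fun _ => mul_zero a, smul_mem_cone (rep_mem_cone_iff.mpr hp) a⟩
  · rintro ⟨hinl, hinr⟩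
    have hsplit : Sum.elim (0 : σ → ℂ) (v ∘ Sum.inr) = v := by rw [← hinl, Sum.elim_comp_inl_inr]
    have hpre : v ∘ Sum.inr ∈ cone (embR σ τ ⁻¹' (embR σ τ '' X)) :=
      cone_subset_cone.mpr (Set.subset_preimage_image _ _) hinr
    rwa [mem_cone_embR_preimage, hsplit] at hpre

theorem IsProjClosed.embR_image {X : Set (PSpace τ)} (hX : IsProjClosed X) :
    IsProjClosed (embR σ τ '' X) := by
  obtain ⟨S, hS, hmem⟩ := hX
  refine ⟨rename Sum.inr '' S ∪ Set.range fun i => MvPolynomial.X (Sum.inl i), ?_, fun p => ?_⟩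
  · rintro _ (⟨f, hf, rfl⟩ | ⟨i, rfl⟩)
    · exact (hS f hf).imp fun e he => he.rename_isHomogeneous
    · exact ⟨1, isHomogeneous_X ℂ _⟩
  have hinr (hinl : p.rep ∘ Sum.inl = 0) :
      p.rep ∘ Sum.inr ∈ cone X ↔ ∀ f ∈ S, eval (p.rep ∘ Sum.inr) f = 0 := by
    have hne : p.rep ∘ Sum.inr ≠ 0 := fun h => p.rep_nonzero <| by
      rw [← Sum.elim_comp_inl_inr p.rep, hinl, h, Sum.elim_zero_zero]
    rw [← mk_mem_iff hne, hmem]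
    refine forall₂_congr fun f hf => ?_
    obtain ⟨e, he⟩ := hS f hf
    exact eval_mk_rep_eq_zero_iff he hne
  rw [← rep_mem_cone_iff, mem_cone_embR_image, and_congr_right hinr, funext_iff, and_comm]
  simp only [Set.mem_union, or_imp, forall_and, Set.forall_mem_image, Set.forall_mem_range,
    eval_rename, eval_X, Function.comp_apply, Pi.zero_apply]

theorem vanishingIdeal_cone_embR_image (X : Set (PSpace τ)) :
    vanishingIdeal ℂ (cone (embR σ τ '' X)) =
      (vanishingIdeal ℂ (cone X)).comap
        (aeval (Sum.elim 0 MvPolynomial.X) : MvPolynomial (σ ⊕ τ) ℂ →ₐ[ℂ] MvPolynomial τ ℂ) := by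
  have heval (f : MvPolynomial (σ ⊕ τ) ℂ) (y : τ → ℂ) :
      eval y (aeval (Sum.elim 0 MvPolynomial.X) f) = eval (Sum.elim 0 y) f := by
    rw [← coe_aeval_eq_eval, ← coe_aeval_eq_eval, RingHom.coe_coe, RingHom.coe_coe,
      comp_aeval_apply]
    congr 2
    ext (i | j) <;> simp
  ext f
  constructor
  · intro hf y hy
    exact (heval f y).trans (hf _ (mem_cone_embR_image.mpr ⟨rfl, hy⟩))
  · intro hf v hv
    obtain ⟨hinl, hinr⟩ := mem_cone_embR_image.mp hv
    rw [← Sum.elim_comp_inl_inr v, hinl]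
    exact (heval f _).symm.trans (hf _ hinr)

theorem coneDim_embR_image (X : Set (PSpace τ)) : coneDim (embR σ τ '' X) = coneDim X := by
  have hsurj : Function.Surjective
      (aeval (Sum.elim 0 MvPolynomial.X) : MvPolynomial (σ ⊕ τ) ℂ →ₐ[ℂ] MvPolynomial τ ℂ) :=
    fun f => ⟨rename Sum.inr f, by rw [aeval_rename, Sum.elim_comp_inr, aeval_X_left_apply]⟩
  exact ringKrullDim_eq_of_ringEquiv <| RingEquiv.ofBijective
    (Ideal.quotientMap _ _ (vanishingIdeal_cone_embR_image X).le)
    ⟨Ideal.quotientMap_injective' (vanishingIdeal_cone_embR_image X).ge,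
      Ideal.quotientMap_surjective hsurj⟩

/-- The quotient map from the coordinate ring of the ambient space of a join with a projective
space onto the polynomial ring, in the coordinates of that projective space, over the coordinate
ring of `W`. -/
def joinQuotientMap (σ : Type) {τ : Type} (W : Set (PSpace τ)) :
    MvPolynomial (σ ⊕ τ) ℂ →+*
      MvPolynomial σ (MvPolynomial τ ℂ ⧸ vanishingIdeal ℂ (cone W)) :=
  (MvPolynomial.map (Ideal.Quotient.mk _)).comp (sumAlgEquiv ℂ σ τ : _ →+* _)

variable (W : Set (PSpace τ))

theorem joinQuotientMap_surjective : Function.Surjective (joinQuotientMap σ W) :=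
  (MvPolynomial.map_surjective _ Ideal.Quotient.mk_surjective).comp (sumAlgEquiv ℂ σ τ).surjective

theorem eval_map_eval_sumAlgEquiv (f : MvPolynomial (σ ⊕ τ) ℂ) (x : σ → ℂ) (y : τ → ℂ) :
    eval x (MvPolynomial.map (eval y) (sumAlgEquiv ℂ σ τ f)) = eval (Sum.elim x y) f := by
  induction f using MvPolynomial.induction_on with
  | C a => simp [sumAlgEquiv_C_inl]
  | add p q hp hq => simp only [map_add, hp, hq]
  | mul_X p q hp =>
    rcases q with i | i <;> simp [hp, sumAlgEquiv_X_inl, sumAlgEquiv_X_inr]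

theorem ker_joinQuotientMap :
    RingHom.ker (joinQuotientMap σ W) =
      vanishingIdeal ℂ (cone (join (Set.univ : Set (PSpace σ)) W)) := by
  ext f
  calc f ∈ RingHom.ker (joinQuotientMap σ W)
      ↔ ∀ y ∈ cone W, MvPolynomial.map (eval y) (sumAlgEquiv ℂ σ τ f) = 0 := by
        simp only [RingHom.mem_ker, joinQuotientMap, RingHom.comp_apply, MvPolynomial.ext_iff,
          coeff_map, coeff_zero, Ideal.Quotient.eq_zero_iff_mem]
        exact ⟨fun h y hy m => h m y hy, fun h m y hy => h y hy m⟩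
    _ ↔ ∀ y ∈ cone W, ∀ x : σ → ℂ, eval (Sum.elim x y) f = 0 := by
        simp only [← eval_map_eval_sumAlgEquiv]
        exact forall₂_congr fun y _ => ⟨fun h x => by rw [h, map_zero],
          fun h => MvPolynomial.funext fun x => by rw [h, map_zero]⟩
    _ ↔ f ∈ vanishingIdeal ℂ (cone (join (Set.univ : Set (PSpace σ)) W)) :=
        ⟨fun h v hv => Sum.elim_comp_inl_inr v ▸ h _ (mem_cone_join_univ.mp hv) _,
          fun h y hy x => h _ (mem_cone_join_univ.mpr hy)⟩

theorem coneDim_join_univ [Fintype σ] [Finite τ] :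
    coneDim (join (Set.univ : Set (PSpace σ)) W) = coneDim W + (Fintype.card σ : ℕ) := by
  rw [coneDim, ← ker_joinQuotientMap, ringKrullDim_eq_of_ringEquiv
    (RingHom.quotientKerEquivOfSurjective (joinQuotientMap_surjective W)),
    MvPolynomial.ringKrullDim_of_isNoetherianRing, Nat.card_eq_fintype_card, coneDim]

variable {W}

theorem isPrime_vanishingIdeal_cone_join_univ (hW : (vanishingIdeal ℂ (cone W)).IsPrime) :
    (vanishingIdeal ℂ (cone (join (Set.univ : Set (PSpace σ)) W))).IsPrime := by
  have : IsDomain (MvPolynomial τ ℂ ⧸ vanishingIdeal ℂ (cone W)) :=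
    (Ideal.Quotient.isDomain_iff_prime _).mpr hW
  exact ker_joinQuotientMap W ▸ RingHom.ker_isPrime _

theorem vanishingIdeal_cone_eq_comap_rename {V : Set (PSpace (σ ⊕ τ))}
    (hVW : V ⊆ join Set.univ W) (hWV : embR σ τ '' W ⊆ V) :
    vanishingIdeal ℂ (cone W) =
      (vanishingIdeal ℂ (cone V)).comap (rename (Sum.inr : τ → σ ⊕ τ)) := by
  ext f
  constructor
  · intro hf v hv
    have hinr := hf _ (mem_cone_join_univ.mp (cone_subset_cone.mpr hVW hv))
    exact (eval_rename _ _ _).trans hinr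
  · intro hf w hw
    have hw0 : Sum.elim (0 : σ → ℂ) w ∈ cone V :=
      cone_subset_cone.mpr hWV (mem_cone_embR_image.mpr ⟨rfl, hw⟩)
    exact (eval_rename Sum.inr (Sum.elim (0 : σ → ℂ) w) f).symm.trans (hf _ hw0)

theorem IsIrredVariety.isPrime_vanishingIdeal_of_embR_image_subset {V : Set (PSpace (σ ⊕ τ))}
    (hV : IsIrredVariety V) (hVW : V ⊆ join Set.univ W) (hWV : embR σ τ '' W ⊆ V) :
    (vanishingIdeal ℂ (cone W)).IsPrime := by
  have := hV.isPrime_vanishingIdeal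
  rw [vanishingIdeal_cone_eq_comap_rename hVW hWV]
  exact Ideal.comap_isPrime _ _

theorem IsIrredVariety.eq_join_univ_of_coneDim_le [Finite σ] [Finite τ]
    {V : Set (PSpace (σ ⊕ τ))} (hV : IsIrredVariety V) (hVW : V ⊆ join Set.univ W)
    (hWV : embR σ τ '' W ⊆ V)
    (hdim : coneDim (join (Set.univ : Set (PSpace σ)) W) ≤ coneDim V) :
    V = join Set.univ W := by
  by_contra hne
  have hlt := (coneDim_add_one_le hV.isClosed (hVW.ssubset_of_ne hne)
    (isPrime_vanishingIdeal_cone_join_univ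
      (hV.isPrime_vanishingIdeal_of_embR_image_subset hVW hWV))).trans hdim
  obtain ⟨d, hd⟩ := exists_coneDim_eq_natCast V
  rw [hd] at hlt
  exact Nat.not_succ_le_self d (by exact_mod_cast hlt)

end Join

/-! ### Rescaling the first group of coordinates -/

section Scaling

open Function (uncurry)

variable {σ τ : Type} {t : ℂ}

/-- The action `(x, y) ↦ (t x, y)`; for `t = 0` it is the projection onto the second group of
coordinates. -/
def scaleVec (t : ℂ) (v : σ ⊕ τ → ℂ) : σ ⊕ τ → ℂ :=
  Sum.elim (t • v ∘ Sum.inl) (v ∘ Sum.inr)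

theorem scaleVec_zero (v : σ ⊕ τ → ℂ) : scaleVec 0 v = Sum.elim (0 : σ → ℂ) (v ∘ Sum.inr) := by
  rw [scaleVec, zero_smul]

theorem scaleVec_scaleVec (s : ℂ) (v : σ ⊕ τ → ℂ) :
    scaleVec s (scaleVec t v) = scaleVec (s * t) v := by
  simp [scaleVec, mul_smul]

theorem scaleVec_one (v : σ ⊕ τ → ℂ) : scaleVec 1 v = v := by
  simp [scaleVec]

theorem scaleVec_ne_zero (ht : t ≠ 0) {v : σ ⊕ τ → ℂ} (hv : v ≠ 0) : scaleVec t v ≠ 0 := by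
  intro h
  refine hv (funext (Sum.rec (fun i => ?_) fun j => congrFun h (Sum.inr j)))
  exact (mul_eq_zero.mp (congrFun h (Sum.inl i))).resolve_left ht

theorem scaleVec_dotProduct [Fintype σ] [Fintype τ] (u v : σ ⊕ τ → ℂ) :
    scaleVec t u ⬝ᵥ v = u ⬝ᵥ scaleVec t v := by
  simp [scaleVec, Matrix.dotProduct_block]

theorem IsProjClosed.scaleVec_zero_mem_cone {V : Set (PSpace (σ ⊕ τ))}
    (hV : IsProjClosed V) {v : σ ⊕ τ → ℂ}
    (h : ∀ t : ℂ, t ≠ 0 → scaleVec t v ∈ cone V) : scaleVec 0 v ∈ cone V := by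
  refine hV.mem_cone_of_forall_add_smul_mem (y := Sum.elim (v ∘ Sum.inl) 0) fun t ht => ?_
  convert h t ht using 1
  ext (i | j) <;> simp [scaleVec]

variable {D : ℕ} {F : MvPolynomial (Fin (D + 1) × (σ ⊕ τ)) ℂ}

theorem eval_scaleForm (ξ : Fin (D + 1) → σ ⊕ τ → ℂ) :
    eval (uncurry ξ) (scaleForm t F) = eval (uncurry fun i => scaleVec t (ξ i)) F := by
  simp only [scaleForm, eval, eval₂Hom_bind₁]
  congr 2
  ext ⟨k, i | j⟩ <;> simp [scaleVec, uncurry]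

theorem scaleForm_scaleForm_inv (ht : t ≠ 0) : scaleForm t (scaleForm t⁻¹ F) = F := by
  refine MvPolynomial.funext fun x => ?_
  rw [← Function.uncurry_curry x, eval_scaleForm, eval_scaleForm]
  simp only [scaleVec_scaleVec, inv_mul_cancel₀ ht, scaleVec_one]

theorem exists_scaleForm_eq_smul (hdvd : ∀ t : ℂ, t ≠ 0 → F ∣ scaleForm t F) (ht : t ≠ 0) :
    ∃ c : ℂ, scaleForm t F = c • F := by
  have hdvd' : scaleForm t F ∣ F := by
    have hinv : scaleForm t F ∣ scaleForm t (scaleForm t⁻¹ F) :=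
      map_dvd (bind₁ _) (hdvd t⁻¹ (inv_ne_zero ht))
    rwa [scaleForm_scaleForm_inv ht] at hinv
  obtain ⟨u, hu⟩ := associated_of_dvd_dvd (hdvd t ht) hdvd'
  obtain ⟨c, -, hc⟩ := isUnit_iff_eq_C_of_isReduced.mp u.isUnit
  exact ⟨c, by rw [← hu, hc, mul_comm, smul_eq_C_mul]⟩

end Scaling

section ChowForm

open Function (uncurry)

variable {σ τ : Type} [Fintype σ] [Fintype τ] {D : ℕ} {V : Set (PSpace (σ ⊕ τ))}
  {F : MvPolynomial (Fin (D + 1) × (σ ⊕ τ)) ℂ} {t : ℂ}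

theorem IsChowForm.eval_scaleForm_of_scaleVec_eq_smul (hF : IsChowForm V F)
    {ξ : Fin (D + 1) → σ ⊕ τ → ℂ} {c : Fin (D + 1) → ℂ} (h : ∀ i, scaleVec t (ξ i) = c i • ξ i) :
    eval (uncurry ξ) (scaleForm t F) = (∏ i, c i) ^ degree V * eval (uncurry ξ) F := by
  rw [eval_scaleForm, funext h, eval_smul_rows hF.isRowHomogeneous_degree, Finset.prod_pow]

theorem IsChowForm.dvd_scaleForm (hF : IsChowForm V F)
    (hV : ∀ v ∈ cone V, scaleVec t⁻¹ v ∈ cone V) (ht : t ≠ 0) : F ∣ scaleForm t F := by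
  refine dvd_of_forall_eval_eq_zero hF.irreducible fun x hx => ?_
  rw [← Function.uncurry_curry x] at hx ⊢
  rw [eval_scaleForm, hF.eval_eq_zero_iff_exists_mem_cone]
  obtain ⟨v, hv, hv0, hvx⟩ := hF.eval_eq_zero_iff_exists_mem_cone.mp hx
  refine ⟨scaleVec t⁻¹ v, hV v hv, scaleVec_ne_zero (inv_ne_zero ht) hv0, fun i => ?_⟩
  rw [scaleVec_dotProduct, scaleVec_scaleVec, mul_inv_cancel₀ ht, scaleVec_one]
  exact hvx i

/-- On a join with `ℙ(σ)`, the coordinate hyperplanes of the first group together with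
`dim W + 1` general hyperplanes in the second group of coordinates have no common point. -/
theorem IsChowForm.exists_eval_ne_zero_and_scaleVec_eq_smul {W : Set (PSpace τ)}
    (hF : IsChowForm (join (Set.univ : Set (PSpace σ)) W) F) (t : ℂ) :
    ∃ (ξ : Fin (D + 1) → σ ⊕ τ → ℂ) (c : Fin (D + 1) → ℂ), eval (uncurry ξ) F ≠ 0 ∧
      (∀ i, scaleVec t (ξ i) = c i • ξ i) ∧ ∏ i, c i = t ^ Fintype.card σ := by
  classical
  obtain ⟨m, hm⟩ := exists_coneDim_eq_natCast W
  obtain ⟨η, hη⟩ := exists_forall_exists_dotProduct_ne_zero hm.le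
  have hcard : D + 1 = Fintype.card σ + m := by
    have hdim := hF.hasDim
    rw [HasDim, coneDim_join_univ, hm] at hdim
    exact_mod_cast hdim.symm.trans (add_comm _ _)
  let e : Fin (D + 1) ≃ σ ⊕ Fin m := Fintype.equivOfCardEq (by simpa using hcard)
  let row : σ ⊕ Fin m → σ ⊕ τ → ℂ :=
    Sum.elim (fun i => Sum.elim (Pi.single i 1) 0) fun k => Sum.elim 0 (η k)
  let weight : σ ⊕ Fin m → ℂ := Sum.elim (fun _ => t) fun _ => 1
  refine ⟨row ∘ e, weight ∘ e, ?_, fun i => ?_, ?_⟩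
  · rw [Ne, hF.eval_eq_zero_iff_exists_mem_cone]
    rintro ⟨v, hv, hv0, hrow⟩
    replace hrow (a) : row a ⬝ᵥ v = 0 := by simpa using hrow (e.symm a)
    have hinl : v ∘ Sum.inl = 0 := funext fun i => by
      simpa [row, Matrix.dotProduct_block] using hrow (Sum.inl i)
    have hinr : v ∘ Sum.inr = 0 := by
      by_contra hne
      obtain ⟨k, hk⟩ := hη _ (mem_cone_join_univ.mp hv) hne
      exact hk (by simpa [row, Matrix.dotProduct_block] using hrow (Sum.inr k))
    exact hv0 (by rw [← Sum.elim_comp_inl_inr v, hinl, hinr, Sum.elim_zero_zero])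
  · have hweight (a) : scaleVec t (row a) = weight a • row a := by
      rcases a with i | k <;> ext (j | j) <;> simp [row, weight, scaleVec]
    exact hweight (e i)
  · simp [e.prod_comp weight, weight, Fintype.prod_sum_type]

theorem IsChowForm.scaleForm_eq_of_join {W : Set (PSpace τ)}
    (hF : IsChowForm (join (Set.univ : Set (PSpace σ)) W) F) (ht : t ≠ 0) :
    scaleForm t F =
      t ^ (Fintype.card σ * degree (join (Set.univ : Set (PSpace σ)) W)) • F := by
  obtain ⟨c, hc⟩ := exists_scaleForm_eq_smul
    (fun s hs => hF.dvd_scaleForm (fun v hv => mem_cone_join_univ.mpr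
      (mem_cone_join_univ.mp hv :)) hs) ht
  obtain ⟨ξ, a, hξ, ha, hprod⟩ := hF.exists_eval_ne_zero_and_scaleVec_eq_smul t
  have heval := hF.eval_scaleForm_of_scaleVec_eq_smul ha
  rw [hc, smul_eval, hprod, ← pow_mul] at heval
  rw [hc, mul_right_cancel₀ hξ heval]

theorem IsChowForm.scaleVec_mem_cone (hF : IsChowForm V F) {c : ℂ} (hc : c ≠ 0)
    (hscale : scaleForm t F = c • F) {v : σ ⊕ τ → ℂ} (hv : v ∈ cone V) :
    scaleVec t v ∈ cone V := by
  by_contra hnot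
  have hv0 : v ≠ 0 := by
    rintro rfl
    exact hnot (by simpa [scaleVec] using zero_mem_cone)
  obtain ⟨ξ, hξv, hξ⟩ := exists_dotProduct_eq_zero_of_notMem_cone (k := D + 1) hnot
    (by exact_mod_cast hF.hasDim.le)
  have hzero : eval (uncurry ξ) (scaleForm t F) = 0 := by
    rw [eval_scaleForm, hF.eval_eq_zero_iff_exists_mem_cone]
    exact ⟨v, hv, hv0, fun i => (scaleVec_dotProduct _ _).trans (hξv i)⟩
  rw [hscale, smul_eval, mul_eq_zero, or_iff_right hc,
    hF.eval_eq_zero_iff_exists_mem_cone] at hzero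
  obtain ⟨u, hu, hu0, hξu⟩ := hzero
  obtain ⟨i, hi⟩ := hξ u hu hu0
  exact hi (hξu i)

end ChowForm

/-! ### Recovering the join from the weights of the Chow form -/

section Weight

open Function (uncurry)

variable {σ τ : Type} {V : Set (PSpace (σ ⊕ τ))} {X W : Set (PSpace τ)}

theorem embR_image_inter_preimage :
    embR σ τ '' (X ∩ embR σ τ ⁻¹' V) = V ∩ embR σ τ '' X := by
  rw [Set.image_inter_preimage, Set.inter_comm]

theorem subset_join_univ_inter_embR_preimage (hVX : V ⊆ join Set.univ X)
    (hproj : ∀ v ∈ cone V, scaleVec 0 v ∈ cone V) :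
    V ⊆ join Set.univ (X ∩ embR σ τ ⁻¹' V) := by
  refine cone_subset_cone.mp fun v hv => mem_cone_join_univ.mpr fun hne => ⟨?_, ?_⟩
  · exact mem_cone_join_univ.mp (cone_subset_cone.mpr hVX hv) hne
  · exact mem_cone_embR_preimage.mpr (scaleVec_zero v ▸ hproj v hv) hne

theorem MeetsProperly.coneDim_eq_coneDim_join_univ [Finite σ] [Finite τ]
    (hVX : MeetsProperly V (embR σ τ '' X) (join Set.univ X))
    (hirred : IsIrredVariety (V ∩ embR σ τ '' X)) :
    coneDim V = coneDim (join (Set.univ : Set (PSpace σ)) (X ∩ embR σ τ ⁻¹' V)) := by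
  cases nonempty_fintype σ
  have hdim := hVX _ ⟨⟨hirred, subset_rfl⟩, fun Z hZ _ => hZ.2⟩
  rw [← embR_image_inter_preimage, coneDim_embR_image, coneDim_embR_image,
    coneDim_join_univ] at hdim
  rw [coneDim_join_univ]
  obtain ⟨x, hx⟩ := exists_coneDim_eq_natCast X
  obtain ⟨v, hv⟩ := exists_coneDim_eq_natCast V
  obtain ⟨w, hw⟩ := exists_coneDim_eq_natCast (X ∩ embR σ τ ⁻¹' V)
  rw [hx, hv, hw] at hdim
  rw [hv, hw]
  norm_cast at hdim ⊢
  lia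

theorem IsIrredVariety.inter_embR_image (hV : IsIrredVariety V) (hX : IsProjClosed X)
    (hVW : V ⊆ join Set.univ (X ∩ embR σ τ ⁻¹' V)) (hne : (X ∩ embR σ τ ⁻¹' V).Nonempty) :
    IsIrredVariety (V ∩ embR σ τ '' X) := by
  refine (hV.isClosed.inter hX.embR_image).isIrredVariety ?_ ?_
  · exact embR_image_inter_preimage ▸ hne.image _
  · have hWV : embR σ τ '' (X ∩ embR σ τ ⁻¹' V) ⊆ V :=
      embR_image_inter_preimage.trans_subset Set.inter_subset_left
    have := hV.isPrime_vanishingIdeal_of_embR_image_subset hVW hWV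
    rw [← embR_image_inter_preimage, vanishingIdeal_cone_embR_image]
    exact Ideal.comap_isPrime _ _

variable [Fintype σ] [Fintype τ] {D : ℕ} {F : MvPolynomial (Fin (D + 1) × (σ ⊕ τ)) ℂ}

/-- On the center of the projection only the first group of coordinates matters, so there the
rescaling by `t` multiplies the Chow form by `t ^ ((D + 1) * degree V)`. -/
theorem IsChowForm.coneDim_eq_card_of_subset_join_empty (hF : IsChowForm V F)
    (hV : V ⊆ join Set.univ ∅)
    (hscale : scaleForm 2 F = (2 : ℂ) ^ (Fintype.card σ * degree V) • F) :
    coneDim V = Fintype.card σ := by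
  have hinr {v} (hv : v ∈ cone V) : v ∘ Sum.inr = 0 := by
    by_contra hne
    exact mem_cone_join_univ.mp (cone_subset_cone.mpr hV hv) hne
  obtain ⟨η, -, hη⟩ := hF.exists_forall_ne_zero_and_eval_ne_zero
  let ξ : Fin (D + 1) → σ ⊕ τ → ℂ := fun i => Sum.elim (η i ∘ Sum.inl) 0
  have hξ : eval (uncurry ξ) F ≠ 0 := by
    rw [Ne, hF.eval_eq_zero_iff_exists_mem_cone] at hη ⊢
    rintro ⟨v, hv, hv0, h⟩
    refine hη ⟨v, hv, hv0, fun i => ?_⟩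
    simpa [ξ, Matrix.dotProduct_block, hinr hv] using h i
  have heval := hF.eval_scaleForm_of_scaleVec_eq_smul (t := 2) (ξ := ξ) (c := fun _ => 2)
    fun i => by ext (j | j) <;> simp [ξ, scaleVec]
  rw [hscale, smul_eval, Fin.prod_const, ← pow_mul] at heval
  have hpow : 2 ^ (Fintype.card σ * degree V) = 2 ^ ((D + 1) * degree V) := by
    exact_mod_cast mul_right_cancel₀ hξ heval
  have hcard := Nat.eq_of_mul_eq_mul_right (Nat.pos_of_ne_zero hF.degree_ne_zero)
    (Nat.pow_right_injective le_rfl hpow)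
  rw [hF.hasDim, hcard]
  norm_cast

theorem IsChowForm.eq_join_of_scaleForm_eq (hF : IsChowForm V F) (hV : IsIrredVariety V)
    (hX : IsProjClosed X) (hVX : V ⊆ join Set.univ X)
    (hproper : MeetsProperly V (embR σ τ '' X) (join Set.univ X))
    (hscale : ∀ t : ℂ, t ≠ 0 → scaleForm t F = t ^ (Fintype.card σ * degree V) • F) :
    V = join Set.univ (X ∩ embR σ τ ⁻¹' V) := by
  have hproj (v) (hv : v ∈ cone V) : scaleVec 0 v ∈ cone V :=
    hV.isClosed.scaleVec_zero_mem_cone fun t ht =>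
      hF.scaleVec_mem_cone (pow_ne_zero _ ht) (hscale t ht) hv
  have hVW := subset_join_univ_inter_embR_preimage hVX hproj
  refine hV.eq_join_univ_of_coneDim_le hVW
    (embR_image_inter_preimage.trans_subset Set.inter_subset_left) (le_of_eq ?_)
  rcases (X ∩ embR σ τ ⁻¹' V).eq_empty_or_nonempty with hW | hW
  · rw [hW] at hVW ⊢
    rw [coneDim_join_univ, coneDim_empty, zero_add,
      hF.coneDim_eq_card_of_subset_join_empty hVW (hscale 2 two_ne_zero)]
  · exact (hproper.coneDim_eq_coneDim_join_univ (hV.inter_embR_image hX hVW hW)).symm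

end Weight

end ChowJoin

end

open ChowJoin in
theorem mainTheorem4_general {σ τ : Type} [Fintype σ] [Fintype τ] {D : ℕ} {X : Set (PSpace τ)}
    (hX : IsProjClosed X) {V : Set (PSpace (σ ⊕ τ))} (hV : IsIrredVariety V)
    (hVX : V ⊆ join Set.univ X)
    (hproper : MeetsProperly V (embR σ τ '' X) (join Set.univ X))
    {F : MvPolynomial (Fin (D + 1) × (σ ⊕ τ)) ℂ} (hF : IsChowForm V F) :
    V = join Set.univ (X ∩ embR σ τ ⁻¹' V) ↔
      ∀ t : ℂ, t ≠ 0 → scaleForm t F = t ^ (Fintype.card σ * degree V) • F := by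
  refine ⟨fun h t ht => ?_, hF.eq_join_of_scaleForm_eq hV hX hVX hproper⟩
  rw [h] at hF ⊢
  exact hF.scaleForm_eq_of_join ht

theorem mainTheorem4 (r n D d : ℕ)
    (X : Set (ChowJoin.PSpace (Fin (n + 1)))) (hX : ChowJoin.IsIrredVariety X)
    (V : Set (ChowJoin.PSpace (Fin (r + 1) ⊕ Fin (n + 1)))) (hV : ChowJoin.IsIrredVariety V)
    (hVX : V ⊆ ChowJoin.join (Set.univ : Set (ChowJoin.PSpace (Fin (r + 1)))) X)
    (hd : ChowJoin.degree V = d)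
    (hproper : ChowJoin.MeetsProperly V (ChowJoin.embR (Fin (r + 1)) (Fin (n + 1)) '' X)
      (ChowJoin.join (Set.univ : Set (ChowJoin.PSpace (Fin (r + 1)))) X))
    (F : MvPolynomial (Fin (D + 1) × (Fin (r + 1) ⊕ Fin (n + 1))) ℂ)
    (hF : ChowJoin.IsChowForm V F) :
    V = ChowJoin.join (Set.univ : Set (ChowJoin.PSpace (Fin (r + 1))))
        (X ∩ ChowJoin.embR (Fin (r + 1)) (Fin (n + 1)) ⁻¹' V) ↔
      ∀ t : ℂ, t ≠ 0 → ChowJoin.scaleForm t F = t ^ ((r + 1) * d) • F := by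
  simpa only [Fintype.card_fin, hd] using
    mainTheorem4_general hX.isClosed hV hVX hproper hF
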